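/- Let $q=2^r$ with $r\ge 1$, let $\mathrm{tr}:\mathbb F_q\to\mathbb F_2$ be the absolute trace, $\lambda(x)=(-1)^{\mathrm{tr}(x)}$ the canonical additive character, and $K(\lambda;a)=\sum_{\alpha\in\mathbb F_q^*}\lambda(\alpha+a\alpha^{-1})$ the Kloosterman sum $(a\in\mathbb F_q^*)$. Let $$P=P(2n,q)=\left\{\begin{bmatrix}A&0\\0&{}^tA^{-1}\end{bmatrix}\begin{bmatrix}1_n&B\\0&1_n\end{bmatrix}\ :\ A\in GL(n,q),\ {}^tB=B\right\}\subset Sp(2n,q),$$ $$\sigma_s=\begin{bmatrix}0&0&1_s&0\\0&1_{n-s}&0&0\\1_s&0&0&0\\0&0&0&1_{n-s}\end{bmatrix}\quad(0\le s\le n),$$ and put $DC^-(n,q)=P\sigma_{n-1}P$ for $n=1,3,5,\dots$ and $DC^+(n,q)=P\sigma_{n-2}P$ for $n=2,4,6,\dots$, with $N^{\mp}(n,q)=|DC^{\mp}(n,q)|$. For any fixed ordering $g_1,\dots,g_N$ of the elements of $DC^{\mp}(n,q)$, where $N=N^{\mp}(n,q)$, let $$C(DC^{\mp}(n,q))=\Big\{u\in\mathbb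 F_2^{N}:\ \sum_{i=1}^N u_i\,\mathrm{Tr}(g_i)=0\Big\},$$ where $\mathrm{Tr}$ is the matrix trace, and let $C_j^{\mp}(n,q)$ be the number of codewords of Hamming weight $j$ in this binary code. With the $q$-binomial coefficients $\left[\substack{n\\ s}\right]_q=\prod_{j=0}^{s-1}(q^{n-j}-1)/(q^{s-j}-1)$, put $$A^-(n,q)=q^{\frac14(5n^2-1)}\left[\substack{n\\1}\right]_q\prod_{j=1}^{(n-1)/2}(q^{2j-1}-1),\qquad B^-(n,q)=q^{\frac14(n-1)^2}(q^n-1)\prod_{j=1}^{(n-1)/2}(q^{2j}-1),$$ $$A^+(n,q)=q^{\frac14(5n^2-2n)}\left[\substack{n\\2}\right]_q\prod_{j=1}^{(n-2)/2}(q^{2j-1}-1),\qquad B^+(n,q)=q^{\frac14(n-2)^2}(q^n-1)(q^{n-1}-1)\prod_{j=1}^{(n-2)/2}(q^{2j}-1).$$ Binomial coefficients $\binom ba$ with $a>b$ are $0$. Then the following hold. (a) For every odd $n\ge1$ and every $j=0,\dots,N^-(n,q)$, $$C_j^-(n,q)=\sum\binom{q^{-1}A^-(n,q)(B^-(n,q)+1)}{\nu_0}\prod_{\substack{\beta\in\mathbb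 F_q^*\\ \mathrm{tr}(\beta^{-1})=0}}\binom{q^{-1}A^-(n,q)(B^-(n,q)+q+1)}{\nu_\beta}\prod_{\substack{\beta\in\mathbb F_q^*\\ \mathrm{tr}(\beta^{-1})=1}}\binom{q^{-1}A^-(n,q)(B^-(n,q)-q+1)}{\nu_\beta}.$$ (b) If $q\ge4$, then for every even $n\ge2$ and every $j=0,\dots,N^+(n,q)$, $$C_j^+(n,q)=\sum\binom{q^{-1}A^+(n,q)(B^+(n,q)+q^3-q^2-1)}{\nu_0}\prod_{\substack{\tau\in\mathbb Z,\ |\tau|<2\sqrt q\\ \tau\equiv-1\ (\mathrm{mod}\ 4)}}\ \prod_{\substack{\beta\in\mathbb F_q^*\\ K(\lambda;\beta^{-1})=\tau}}\binom{q^{-1}A^+(n,q)(B^+(n,q)+q\tau-q^2-1)}{\nu_\beta}.$$ In both cases the sum is over all families $\{\nu_\beta\}_{\beta\in\mathbb F_q}$ of nonnegative integers with $\sum_{\beta\in\mathbb F_q}\nu_\beta=j$ and $\sum_{\beta\in\mathbb F_q}\nu_\beta\beta=0$ in $\mathbb F_q$. -/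

import Mathlib

open scoped BigOperators

noncomputable section

namespace SpCode

/-! ### Numerical notation -/

/-- The binomial coefficient `b choose a`, with the convention that it is `0` when `a > b`.
For a natural number `b` this is the usual `Nat.choose b a`. -/
def binom (b : ℚ) (a : ℕ) : ℚ := if (a : ℚ) ≤ b then Ring.choose b a else 0

/-- On natural numbers `binom` is the usual binomial coefficient. -/
theorem binom_natCast (b a : ℕ) : binom (b : ℚ) a = (b.choose a : ℚ) := by
  unfold binom
  split_ifs with h
  · exact Ring.choose_natCast b a
  · have h' : b < a := by
      by_contra hc
      exact h (by exact_mod_cast not_lt.mp hc)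
    simp [Nat.choose_eq_zero_of_lt h']

/-- The `q`-binomial coefficient `∏_{j < r} (q^(n-j) - 1) / (q^(r-j) - 1)`, for `r ≤ n`. -/
def qBinom (n r q : ℕ) : ℚ :=
  ∏ j ∈ Finset.range r, ((q : ℚ) ^ (n - j) - 1) / ((q : ℚ) ^ (r - j) - 1)

/-- `A⁻(n,q)`, used for odd `n` only (all the divisions in `ℕ` are exact there). -/
def Aminus (n q : ℕ) : ℚ :=
  (q : ℚ) ^ ((5 * n ^ 2 - 1) / 4) * qBinom n 1 q *
    ∏ j ∈ Finset.Icc 1 ((n - 1) / 2), ((q : ℚ) ^ (2 * j - 1) - 1)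

/-- `B⁻(n,q)`, used for odd `n` only (all the divisions in `ℕ` are exact there). -/
def Bminus (n q : ℕ) : ℚ :=
  (q : ℚ) ^ ((n - 1) ^ 2 / 4) * ((q : ℚ) ^ n - 1) *
    ∏ j ∈ Finset.Icc 1 ((n - 1) / 2), ((q : ℚ) ^ (2 * j) - 1)

/-- `A⁺(n,q)`, used for even `n ≥ 2` only (all the divisions in `ℕ` are exact there). -/
def Aplus (n q : ℕ) : ℚ :=
  (q : ℚ) ^ ((5 * n ^ 2 - 2 * n) / 4) * qBinom n 2 q *
    ∏ j ∈ Finset.Icc 1 ((n - 2) / 2), ((q : ℚ) ^ (2 * j - 1) - 1)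

/-- `B⁺(n,q)`, used for even `n ≥ 2` only (all the divisions in `ℕ` are exact there). -/
def Bplus (n q : ℕ) : ℚ :=
  (q : ℚ) ^ ((n - 2) ^ 2 / 4) * ((q : ℚ) ^ n - 1) * ((q : ℚ) ^ (n - 1) - 1) *
    ∏ j ∈ Finset.Icc 1 ((n - 2) / 2), ((q : ℚ) ^ (2 * j) - 1)

/-! ### Double cosets in the symplectic group -/

/-- The maximal parabolic subgroup `P(2n,q)` of `Sp(2n,q)`, as a set of `2n × 2n` matrices. -/
def parabolic (n : ℕ) (F : Type*) [Field F] :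
    Set (Matrix (Fin n ⊕ Fin n) (Fin n ⊕ Fin n) F) :=
  {w | ∃ A B : Matrix (Fin n) (Fin n) F, IsUnit A.det ∧ B.transpose = B ∧
    w = Matrix.fromBlocks A 0 0 A⁻¹.transpose * Matrix.fromBlocks 1 B 0 1}

/-- The matrix `σ_r`, for `0 ≤ r ≤ n`: its upper right and lower left blocks are
`diag(1_r, 0)`, the two other blocks are `diag(0, 1_{n-r})`. -/
def sigma (n r : ℕ) (F : Type*) [Field F] : Matrix (Fin n ⊕ Fin n) (Fin n ⊕ Fin n) F :=
  Matrix.fromBlocks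
    (Matrix.diagonal fun i : Fin n => if (i : ℕ) < r then 0 else 1)
    (Matrix.diagonal fun i : Fin n => if (i : ℕ) < r then 1 else 0)
    (Matrix.diagonal fun i : Fin n => if (i : ℕ) < r then 1 else 0)
    (Matrix.diagonal fun i : Fin n => if (i : ℕ) < r then 0 else 1)

/-- `DC⁻(n,q) = P σ_{n-1} P` (for odd `n`). -/
def DCminus (n : ℕ) (F : Type*) [Field F] :
    Set (Matrix (Fin n ⊕ Fin n) (Fin n ⊕ Fin n) F) :=
  DoubleCoset.doubleCoset (sigma n (n - 1) F) (parabolic n F) (parabolic n F)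

/-- `DC⁺(n,q) = P σ_{n-2} P` (for even `n ≥ 2`). -/
def DCplus (n : ℕ) (F : Type*) [Field F] :
    Set (Matrix (Fin n ⊕ Fin n) (Fin n ⊕ Fin n) F) :=
  DoubleCoset.doubleCoset (sigma n (n - 2) F) (parabolic n F) (parabolic n F)

/-- `N⁻(n,q) = |DC⁻(n,q)|`. -/
def Nminus (n : ℕ) (F : Type*) [Field F] : ℕ := Nat.card (DCminus n F)

/-- `N⁺(n,q) = |DC⁺(n,q)|`. -/
def Nplus (n : ℕ) (F : Type*) [Field F] : ℕ := Nat.card (DCplus n F)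

/-! ### The binary codes -/

/-- For an enumeration `g_1, …, g_N` of a set `S` of square matrices over `F`, the binary linear
code of all `u ∈ 𝔽_2^N` with `u · v = 0`, where `v = (Tr g_1, …, Tr g_N) ∈ F^N`. -/
def traceCode {F : Type*} [Field F] [Algebra (ZMod 2) F] {m : Type*} [Fintype m]
    {S : Set (Matrix m m F)} {N : ℕ} (g : Fin N ≃ S) :
    Submodule (ZMod 2) (Fin N → ZMod 2) where
  carrier := {u | ∑ i, algebraMap (ZMod 2) F (u i) * (g i : Matrix m m F).trace = 0}
  add_mem' := by
    intro a b ha hb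
    simp only [Set.mem_ofPred_eq, Pi.add_apply, map_add, add_mul, Finset.sum_add_distrib] at *
    rw [ha, hb, add_zero]
  zero_mem' := by simp
  smul_mem' := by
    intro c x hx
    simp only [Set.mem_ofPred_eq, Pi.smul_apply, smul_eq_mul, map_mul, mul_assoc,
      ← Finset.mul_sum] at *
    rw [hx, mul_zero]

/-- The number of codewords of Hamming weight `j`. -/
def weightCount {N : ℕ} (C : Submodule (ZMod 2) (Fin N → ZMod 2)) (j : ℕ) : ℕ :=
  Nat.card {u : Fin N → ZMod 2 // u ∈ C ∧ hammingNorm u = j}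

/-! ### The trace function, the canonical additive character, Kloosterman sums -/

section Field

variable (F : Type*) [Field F] [Fintype F] [Algebra (ZMod 2) F]

/-- The absolute trace `tr : 𝔽_q → 𝔽_2`. -/
def tr (x : F) : ZMod 2 := Algebra.trace (ZMod 2) F x

/-- The canonical additive character `λ(x) = (-1)^tr(x)`. -/
def canonicalChar (x : F) : ℤ := (-1) ^ (tr F x).val

/-- The Kloosterman sum `K(λ; a)`. -/
def kloosterman [DecidableEq F] (a : F) : ℤ :=
  ∑ α : Fˣ, canonicalChar F ((α : F) + a * (α : F)⁻¹)

end Field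

open Classical in
/-- The finite set of integers `τ` with `|τ| < 2√q` and `τ ≡ -1 (mod 4)`. -/
def tauRange (q : ℕ) : Finset ℤ :=
  (Finset.Icc (-(2 * q : ℤ)) (2 * q)).filter
    fun τ => |(τ : ℝ)| < 2 * Real.sqrt q ∧ τ ≡ -1 [ZMOD 4]

/-- The bounds `-2q ≤ τ ≤ 2q` in `tauRange` are no restriction. -/
theorem mem_tauRange (q : ℕ) (τ : ℤ) :
    τ ∈ tauRange q ↔ |(τ : ℝ)| < 2 * Real.sqrt q ∧ τ ≡ -1 [ZMOD 4] := by
  unfold tauRange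
  rw [Finset.mem_filter, and_iff_right_iff_imp]
  rintro ⟨h, -⟩
  have hs : Real.sqrt q ≤ q := by
    rcases Nat.eq_zero_or_pos q with rfl | hq
    · simp
    · have h1 : (1 : ℝ) ≤ q := by exact_mod_cast hq
      rw [Real.sqrt_le_left (by positivity)]
      nlinarith
  have h2 := abs_lt.mp h
  rw [Finset.mem_Icc]
  constructor
  · have : (-(2 * q : ℝ)) ≤ τ := by linarith [h2.1]
    exact_mod_cast this
  · have : (τ : ℝ) ≤ 2 * q := by linarith [h2.2]
    exact_mod_cast this

/-- The families `(ν_β)` of nonnegative integers, indexed by `β ∈ 𝔽_q`, with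
`∑ ν_β = j` and `∑ ν_β β = 0`. -/
def families (F : Type*) [Field F] [Fintype F] [DecidableEq F] (j : ℕ) : Finset (F → ℕ) :=
  (Finset.piAntidiag Finset.univ j).filter fun ν => ∑ β, (ν β : F) * β = 0

/-- Membership in `families`. -/
theorem mem_families {F : Type*} [Field F] [Fintype F] [DecidableEq F] (j : ℕ) (ν : F → ℕ) :
    ν ∈ families F j ↔ ∑ β, ν β = j ∧ ∑ β, (ν β : F) * β = 0 := by
  simp [families, Finset.mem_piAntidiag]

end SpCode

end

/-! A codeword is a set of elements of the double coset whose traces sum to zero. Its weight and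
this condition depend only on how many elements it takes from each trace fibre, so the weight
distribution is determined by the fibre sizes N_β = #{w : Tr w = β} (`weightCount_traceCode`). The
remaining task is to compute N_β.

The trace is a class function, so N_β · |P ∩ σPσ⁻¹| = |P| · #{p ∈ P : Tr(pσ) = β}
(`card_doubleCoset_mul_card`). With p given by (A, B) and D = diag(1_s, 0), Tr(pσ) is Tr(DAB) plus a
term in A alone. For fixed A the functional B ↦ Tr(DAB) on symmetric matrices is equidistributed
unless it vanishes, that is, unless DA is alternating (`card_mul_pairTraceCount`). In that case A is
block lower triangular, with an invertible alternating corner of size s and an arbitrary invertible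
corner of size n - s, which is 1 or 2. So N_β is a constant plus a multiple of the number of
invertible matrices M of size n - s with Tr M + Tr M⁻¹ = β. In size 1 this is a quadratic equation
of Artin–Schreier type; in size 2, sorting by trace and determinant produces K(λ; β⁻¹).

Part (b) groups the β by the value τ of the Kloosterman sum, so every value must lie in the stated
range. The congruence modulo 4 comes from an involution. The bound comes from Manin's elementary
proof of Hasse's theorem: on a curve over F(t) isomorphic to z² + z = x + a/x + t + a/t, let Q have
x = t and let P₀ be the Frobenius point with x = t^q. The numerator of x(P₀ + nQ) has degree n² -
K(λ; a)n + q, which is nonnegative for every integer n (`frobenius_quadratic_nonneg`). -/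

namespace SpCode

/-! ### The twisted curve and the x-coordinates of P ± Q -/

section Curve

open WeierstrassCurve Affine

variable {K : Type*} [Field K]

/-- The curve `Y² + XY = X³ + (t + a / t) X² + a X`. -/
def twistedCurve (t a : K) : WeierstrassCurve.Affine K :=
  ⟨1, t + a / t, 0, a, 0⟩

variable {t a : K}

theorem twistedCurve_equation_iff (x y : K) :
    (twistedCurve t a).Equation x y ↔ y ^ 2 + x * y = x ^ 3 + (t + a / t) * x ^ 2 + a * x := by
  simp [Affine.equation_iff, twistedCurve]

variable [CharP K 2]

theorem twistedCurve_nonsingular (ha : a ≠ 0) {x y : K} (h : (twistedCurve t a).Equation x y) :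
    (twistedCurve t a).Nonsingular x y := by
  rw [Affine.nonsingular_iff]
  refine ⟨h, ?_⟩
  by_contra hc
  push Not at hc
  obtain ⟨h1, h2⟩ := hc
  have two : (2 : K) = 0 := CharTwo.two_eq_zero
  rw [twistedCurve_equation_iff] at h
  simp only [twistedCurve] at h1 h2
  have hx : x = 0 := by grind
  subst hx
  have hy : y = a := by linear_combination h1
  have : a ^ 2 = 0 := by rw [hy] at h; linear_combination h
  exact ha (pow_eq_zero_iff two_ne_zero |>.1 this)

/-- The x-coordinates of P + Q and P - Q are the two roots of a quadratic whose coefficients are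
quadratic forms in the x-coordinate of P. Homogeneous coordinates let one statement cover P = 0 and
P = ±Q as well. -/
theorem xRep_add_sub [DecidableEq K] (ht : t ≠ 0) (hQ : (twistedCurve t a).Nonsingular t 0)
    (P : (twistedCurve t a).Point) :
    ∃ c : K, c ≠ 0 ∧
      (P + .some _ _ hQ).xRep 1 * (P - .some _ _ hQ).xRep 1 =
        c * (P.xRep 0 + t * P.xRep 1) ^ 2 ∧
      (P + .some _ _ hQ).xRep 0 * (P - .some _ _ hQ).xRep 1 +
        (P + .some _ _ hQ).xRep 1 * (P - .some _ _ hQ).xRep 0 = c * (t * P.xRep 0 * P.xRep 1) ∧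
      (P + .some _ _ hQ).xRep 0 * (P - .some _ _ hQ).xRep 0 =
        c * (t * P.xRep 0 + a * P.xRep 1) ^ 2 := by
  have two : (2 : K) = 0 := CharTwo.two_eq_zero
  have hnegQ : -Point.some _ _ hQ = Point.some t t
      ((nonsingular_neg _ _).2 hQ |> fun h => by
        simpa [negY, twistedCurve, CharTwo.neg_eq] using h) := by
    rw [Point.neg_some]
    congr 1
    simp [negY, twistedCurve, CharTwo.neg_eq]
  -- When P = ±Q, one of P ± Q is zero and the other is ±2Q.
  have hdbl : (Point.some _ _ hQ + Point.some _ _ hQ).xRep = ![((t ^ 2 + a) / t) ^ 2, 1] := by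
    have hne : (0 : K) ≠ (twistedCurve t a).negY t 0 := by
      simpa [negY, twistedCurve] using ht
    rw [Point.add_self_of_Y_ne hne, Point.xRep_some, slope_of_Y_ne rfl hne]
    congr 1
    simp only [addX, negY, twistedCurve]
    have : (0 : K) - (-0 - 1 * t - 0) = t := by ring
    rw [this]
    field_simp
    grind
  match P with
  | 0 =>
    refine ⟨1, one_ne_zero, ?_⟩
    rw [zero_add, zero_sub, hnegQ]
    simp [pow_two, CharTwo.add_self_eq_zero]
  | .some x y h =>
    by_cases hx : x = t
    · rcases (Point.X_eq_iff (h₁ := h) (h₂ := hQ)).1 hx with hP | hP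
      · rw [hP, sub_self, hdbl]
        refine ⟨1 / t ^ 2, by simpa using ht, ?_⟩
        simp [CharTwo.add_self_eq_zero]
        field_simp
        simp
      · rw [hP, neg_add_cancel, ← neg_add', Point.xRep_neg, hdbl, Point.xRep_neg]
        refine ⟨1 / t ^ 2, by simpa using ht, ?_⟩
        simp [CharTwo.add_self_eq_zero]
        field_simp
        simp
    · have hxt : x + t ≠ 0 := fun h0 => hx (CharTwo.add_eq_zero.1 h0)
      have heq := (twistedCurve_equation_iff x y).1 h.1
      have hsub : ∀ u v : K, u - v = u + v := CharTwo.sub_eq_add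
      have hD : t * (t + a / t) = t ^ 2 + a := by field_simp
      rw [sub_eq_add_neg (Point.some x y h), hnegQ, Point.add_of_X_ne hx, Point.add_of_X_ne hx]
      simp only [Point.xRep_some]
      rw [slope_of_X_ne hx, slope_of_X_ne hx]
      simp only [addX, twistedCurve]
      refine ⟨1 / (x + t) ^ 2, by simpa using hxt, ?_, ?_, ?_⟩
      · simp; field_simp
      · simp; field_simp; grind
      · simp; field_simp; grind

end Curve

/-! ### Reduced fractions and the degree recurrence -/

section Reduced

open Polynomial WeierstrassCurve Affine

variable {F : Type*} [Field F] {K : Type*} [Field K] [Algebra F[X] K] [IsFractionRing F[X] K]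

/-- The reduced fraction `f / g` represents the point `v` of the projective line over `F(X)`. -/
def IsReducedRep (v : Fin 2 → K) (f g : F[X]) : Prop :=
  IsCoprime f g ∧ ∃ u : K, u ≠ 0 ∧ v 0 = u * algebraMap F[X] K f ∧ v 1 = u * algebraMap F[X] K g

theorem exists_isReducedRep {v : Fin 2 → K} (hv : v ≠ 0) :
    ∃ f g : F[X], IsReducedRep v f g := by
  by_cases h1 : v 1 = 0
  · refine ⟨1, 0, isCoprime_one_left, v 0, ?_, by simp, by simp [h1]⟩
    intro h0
    apply hv
    ext i
    fin_cases i <;> simp [h0, h1]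
  · obtain ⟨f, g, hfg, hg⟩ := IsFractionRing.exists_reduced_fraction (A := F[X]) (v 0 / v 1)
    have hg0 : algebraMap F[X] K g ≠ 0 := IsFractionRing.to_map_ne_zero_of_mem_nonZeroDivisors g.2
    rw [IsFractionRing.mk'_eq_div, div_eq_div_iff hg0 h1] at hg
    refine ⟨f, g, hfg.isCoprime, v 1 / algebraMap F[X] K g, div_ne_zero h1 hg0, ?_, ?_⟩
    · field_simp
      linear_combination -hg
    · field_simp

/-- Numerators and denominators are chosen arbitrarily later on. Reduced fractions are unique up to
units, so the degrees do not depend on the choice. -/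
theorem IsReducedRep.degree_eq {v : Fin 2 → K} {f g f' g' : F[X]} (h : IsReducedRep v f g)
    (h' : IsReducedRep v f' g') : f.degree = f'.degree ∧ g.degree = g'.degree := by
  obtain ⟨hc, u, hu, h0, h1⟩ := h
  obtain ⟨hc', u', hu', h0', h1'⟩ := h'
  have hinj := IsFractionRing.injective F[X] K
  have hcross : f * g' = f' * g := by
    apply hinj
    simp only [map_mul]
    have e1 := h0.symm.trans h0'
    have e2 := h1.symm.trans h1'
    apply mul_left_cancel₀ (mul_ne_zero hu hu')
    linear_combination (algebraMap F[X] K g') * u' * e1 - u' * algebraMap F[X] K f' * e2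
  constructor <;> refine degree_eq_degree_of_associated (associated_of_dvd_dvd ?_ ?_)
  · exact hc.dvd_of_dvd_mul_right ⟨g', hcross.symm⟩
  · exact hc'.dvd_of_dvd_mul_right ⟨g, hcross⟩
  · exact hc.symm.dvd_of_dvd_mul_left ⟨f', by rw [hcross, mul_comm]⟩
  · exact hc'.symm.dvd_of_dvd_mul_left ⟨f, by rw [← hcross, mul_comm]⟩

/-- Two primitive triples of polynomials that are proportional over `F(X)` are proportional
over `F`. -/
theorem exists_C_mul_eq {ι : Type*} (p s : ι → F[X]) {c : K} (hc : c ≠ 0)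
    (hps : ∀ i, algebraMap F[X] K (p i) = c * algebraMap F[X] K (s i))
    (hp : ∀ π : F[X], Prime π → ∃ i, ¬ π ∣ p i) (hs : ∀ π : F[X], Prime π → ∃ i, ¬ π ∣ s i) :
    ∃ u : F, u ≠ 0 ∧ ∀ i, p i = C u * s i := by
  have hinj := IsFractionRing.injective F[X] K
  obtain ⟨f, g, hfg, rfl⟩ := IsFractionRing.exists_reduced_fraction (A := F[X]) c
  have hfg := hfg.isCoprime
  have hg0 : algebraMap F[X] K g ≠ 0 := IsFractionRing.to_map_ne_zero_of_mem_nonZeroDivisors g.2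
  rw [IsFractionRing.mk'_eq_div] at hc hps
  have key : ∀ i, (g : F[X]) * p i = f * s i := by
    intro i
    apply hinj
    rw [map_mul, map_mul, hps i]
    field_simp
  have hf0 : f ≠ 0 := by
    rintro rfl
    simp at hc
  have hgu : IsUnit (g : F[X]) := by
    by_contra hgu
    obtain ⟨π, hπ, hdvd⟩ := WfDvdMonoid.exists_irreducible_factor hgu
      (nonZeroDivisors.ne_zero g.2)
    obtain ⟨i, hi⟩ := hs π hπ.prime
    rcases hπ.prime.dvd_or_dvd ((hdvd.mul_right (p i)).trans (key i).dvd) with h | h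
    · exact hπ.not_isUnit (hfg.isUnit_of_dvd' h hdvd)
    · exact hi h
  have hfu : IsUnit f := by
    by_contra hfu
    obtain ⟨π, hπ, hdvd⟩ := WfDvdMonoid.exists_irreducible_factor hfu hf0
    obtain ⟨i, hi⟩ := hp π hπ.prime
    rcases hπ.prime.dvd_or_dvd ((hdvd.mul_right (s i)).trans (key i).symm.dvd) with h | h
    · exact hπ.not_isUnit (hfg.isUnit_of_dvd' hdvd h)
    · exact hi h
  obtain ⟨m, hm, hmf⟩ := Polynomial.isUnit_iff.1 hfu
  obtain ⟨n, hn, hng⟩ := Polynomial.isUnit_iff.1 hgu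
  refine ⟨m / n, div_ne_zero hm.ne_zero hn.ne_zero, fun i => ?_⟩
  have := key i
  rw [← hmf, ← hng] at this
  have hn' : C n⁻¹ * C n = 1 := by rw [← C_mul, inv_mul_cancel₀ hn.ne_zero, C_1]
  rw [div_eq_mul_inv, C_mul]
  linear_combination C n⁻¹ * this - p i * hn'

/-- The relations of `xRep_add_sub` hold up to a factor in F(X). Both triples of polynomials are
primitive, so that factor is a constant. On the left this follows from coprimality of the two
neighbouring fractions; on the right from that of f and g, where a ≠ 0 rules out the prime X. -/
theorem exists_unit_neighbors [CharP F 2] [DecidableEq K] {a : F} (ha : a ≠ 0)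
    (hQ : (twistedCurve (algebraMap F[X] K X) (algebraMap F[X] K (C a))).Nonsingular
      (algebraMap F[X] K X) 0)
    (P : (twistedCurve (algebraMap F[X] K X) (algebraMap F[X] K (C a))).Point)
    {f g f₃ g₃ f₄ g₄ : F[X]} (h : IsReducedRep P.xRep f g)
    (h₃ : IsReducedRep (P + .some _ _ hQ).xRep f₃ g₃)
    (h₄ : IsReducedRep (P - .some _ _ hQ).xRep f₄ g₄) :
    ∃ u : F, u ≠ 0 ∧ f₃ * g₄ + g₃ * f₄ = C u * (X * f * g) ∧
      f₃ * f₄ = C u * (X * f + C a * g) ^ 2 := by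
  have : CharP K 2 := by
    have : CharP F[X] 2 := inferInstance
    exact charP_of_injective_algebraMap (IsFractionRing.injective F[X] K) 2
  have hX : algebraMap F[X] K X ≠ 0 := by
    simp
  obtain ⟨c, hc, e1, e2, e3⟩ := xRep_add_sub hX hQ P
  obtain ⟨hfg, u, hu, h0, h1⟩ := h
  obtain ⟨hfg₃, u₃, hu₃, h₃0, h₃1⟩ := h₃
  obtain ⟨hfg₄, u₄, hu₄, h₄0, h₄1⟩ := h₄
  rw [h₃0, h₄0, h0, h1] at e3
  rw [h₃1, h₄1, h0, h1] at e1
  rw [h₃0, h₄0, h₃1, h₄1, h0, h1] at e2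
  have h34 : u₃ * u₄ ≠ 0 := mul_ne_zero hu₃ hu₄
  suffices h : ∃ w : F, w ≠ 0 ∧ ∀ i, (![g₃ * g₄, f₃ * g₄ + g₃ * f₄, f₃ * f₄] : Fin 3 → F[X]) i =
      C w * (![(f + X * g) ^ 2, X * f * g, (X * f + C a * g) ^ 2] : Fin 3 → F[X]) i by
    obtain ⟨w, hw, hall⟩ := h
    exact ⟨w, hw, hall 1, hall 2⟩
  refine exists_C_mul_eq (K := K) (c := c * u ^ 2 / (u₃ * u₄)) _ _
    (div_ne_zero (mul_ne_zero hc (pow_ne_zero 2 hu)) h34) ?_ ?_ ?_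
  · intro i
    rw [div_mul_eq_mul_div, eq_div_iff h34]
    fin_cases i <;> simp <;> grind
  · intro π hπ
    by_contra! hdvd
    have d1 : π ∣ g₃ * g₄ := hdvd 0
    have d2 : π ∣ f₃ * g₄ + g₃ * f₄ := hdvd 1
    have d3 : π ∣ f₃ * f₄ := hdvd 2
    have n3 : ¬ (π ∣ f₃ ∧ π ∣ g₃) := fun h => hπ.not_isUnit (hfg₃.isUnit_of_dvd' h.1 h.2)
    have n4 : ¬ (π ∣ f₄ ∧ π ∣ g₄) := fun h => hπ.not_isUnit (hfg₄.isUnit_of_dvd' h.1 h.2)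
    rcases hπ.dvd_or_dvd d1 with h | h <;> rcases hπ.dvd_or_dvd d3 with h' | h'
    · exact n3 ⟨h', h⟩
    · have := (dvd_add_left (h.mul_right f₄)).1 d2
      rcases hπ.dvd_or_dvd this with h'' | h''
      · exact n3 ⟨h'', h⟩
      · exact n4 ⟨h', h''⟩
    · have := (dvd_add_right (h.mul_left f₃)).1 d2
      rcases hπ.dvd_or_dvd this with h'' | h''
      · exact n3 ⟨h', h''⟩
      · exact n4 ⟨h'', h⟩
    · exact n4 ⟨h', h⟩
  · intro π hπ
    by_contra! hdvd
    have d1 : π ∣ f + X * g := hπ.dvd_of_dvd_pow (hdvd 0)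
    have d2 : π ∣ X * f * g := hdvd 1
    have d3 : π ∣ X * f + C a * g := hπ.dvd_of_dvd_pow (hdvd 2)
    have n : π ∣ f → π ∣ g → False := fun h h' => hπ.not_isUnit (hfg.isUnit_of_dvd' h h')
    have hXn : ¬ π ∣ X := fun hX => by
      have hf := (dvd_add_left (hX.mul_right g)).1 d1
      have hg := (dvd_add_right (hX.mul_right f)).1 d3
      rcases hπ.dvd_or_dvd hg with h | h
      · exact hπ.not_isUnit (isUnit_of_dvd_unit h (isUnit_C.2 (isUnit_iff_ne_zero.2 ha)))
      · exact n hf h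
    rcases hπ.dvd_or_dvd d2 with h | h
    · rcases hπ.dvd_or_dvd h with h | h
      · exact hXn h
      · rcases hπ.dvd_or_dvd ((dvd_add_right h).1 d1) with h' | h'
        · exact hXn h'
        · exact n h h'
    · exact n ((dvd_add_left (h.mul_left X)).1 d1) h

/-- Since X f dominates a g, the product f₃ f₄ has degree 2(deg f + 1): a parallelogram law for the
degree. The condition deg g < deg f says that x has a pole at infinity. If it held for f₃ / g₃ but
failed for f₄ / g₄, then f₃ g₄ would dominate the mixed sum, giving deg f₃ f₄ ≤ deg X f g, which is
too small. -/
theorem degree_neighbors {a u : F} (hu : u ≠ 0) {f g f₃ g₃ f₄ g₄ : F[X]}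
    (h1 : f₃ * g₄ + g₃ * f₄ = C u * (X * f * g)) (h2 : f₃ * f₄ = C u * (X * f + C a * g) ^ 2)
    (hfg : g.degree < f.degree) :
    f₃.natDegree + f₄.natDegree = 2 * f.natDegree + 2 ∧
      (g₃.degree < f₃.degree → g₄.degree < f₄.degree) := by
  have hf0 : f ≠ 0 := by rintro rfl; simp at hfg
  have hCu : (C u : F[X]) ≠ 0 := C_ne_zero.2 hu
  have hXf : (X * f).degree = f.degree + 1 := by rw [degree_mul, degree_X, add_comm]
  have hlt : (C a * g).degree < (X * f).degree := by
    rw [← smul_eq_C_mul]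
    refine (degree_smul_le a g).trans_lt (hfg.trans_le ?_)
    rw [mul_comm]
    exact degree_le_mul_left f X_ne_zero
  have hsum : (X * f + C a * g).degree = (X * f).degree := degree_add_eq_left_of_degree_lt hlt
  have hne : X * f + C a * g ≠ 0 := by
    intro h; rw [h, degree_zero, eq_comm, degree_eq_bot] at hsum
    exact mul_ne_zero X_ne_zero hf0 hsum
  have hprod : f₃ * f₄ ≠ 0 := by rw [h2]; exact mul_ne_zero hCu (pow_ne_zero 2 hne)
  have hf₃ := left_ne_zero_of_mul hprod
  have hf₄ := right_ne_zero_of_mul hprod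
  constructor
  · rw [← natDegree_mul hf₃ hf₄, h2, natDegree_C_mul hu, natDegree_pow,
      natDegree_eq_of_degree_eq hsum, natDegree_X_mul hf0]
    ring
  · intro h3
    by_contra! h4
    have hg₄ : g₄ ≠ 0 := by rintro rfl; simp [hf₄] at h4
    have hd : (g₃ * f₄).degree < (f₃ * g₄).degree := by
      rw [degree_mul, degree_mul]
      calc g₃.degree + f₄.degree ≤ g₃.degree + g₄.degree := by gcongr
        _ < _ := by
          rw [degree_eq_natDegree hg₄]
          exact WithBot.add_lt_add_right (by simp) h3
    have e1 : (f₃ * g₄).degree = (C u * (X * f * g)).degree := by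
      rw [← h1, degree_add_eq_left_of_degree_lt hd]
    have hg0 : g ≠ 0 := by
      rintro rfl
      rw [mul_zero, mul_zero, degree_zero, degree_eq_bot] at e1
      exact mul_ne_zero hf₃ hg₄ e1
    have e3 : (f₃ * f₄).degree ≤ (f₃ * g₄).degree := by
      rw [degree_mul, degree_mul]; gcongr
    rw [e1, h2, degree_mul, degree_mul, degree_pow, hsum, degree_mul, degree_mul, degree_X,
      degree_C hu, two_nsmul, degree_mul, degree_X, degree_eq_natDegree hf0, degree_eq_natDegree hg0] at e3
    rw [degree_eq_natDegree hf0, degree_eq_natDegree hg0] at hfg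
    norm_cast at e3 hfg
    omega

end Reduced

/-! ### The Frobenius point and the cancellation in x(P₀ + Q) -/

section Frobenius

open Polynomial

variable {F : Type*} [Field F]

/-- `X ^ (q + 1)` times the sum of the first `k` iterated squares of `X + a / X`. -/
noncomputable def iteratedSquares (q : ℕ) (a : F) (k : ℕ) : F[X] :=
  ∑ i ∈ Finset.range k, X ^ (q + 1 - 2 ^ i) * (X ^ 2 + C a) ^ 2 ^ i

/-- With u = X + a/X and S the sum of u^(2^i) for i < k, this is the telescoping identity S² + S =
u^(2^k) + u multiplied by X^(2q+2). Putting y = xz turns the twisted curve into z² + z = x + a/x + t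
+ a/t, so for 2^k = q the choice x = t^q, z = S gives a point. -/
theorem iteratedSquares_artinSchreier [CharP F 2] {q : ℕ} (a : F) {k : ℕ} (hk : 2 ^ k ≤ q) :
    iteratedSquares q a k ^ 2 + X ^ (q + 1) * iteratedSquares q a k =
      X ^ (2 * q + 2 - 2 ^ k) * (X ^ 2 + C a) ^ 2 ^ k + X ^ (2 * q + 1) * (X ^ 2 + C a) := by
  induction k with
  | zero =>
    simp [iteratedSquares, CharTwo.add_self_eq_zero]
  | succ k ih =>
    have hk' : 2 * 2 ^ k ≤ q := by rwa [pow_succ'] at hk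
    have ih := ih (by omega)
    have hs : iteratedSquares q a (k + 1) =
        iteratedSquares q a k + X ^ (q + 1 - 2 ^ k) * (X ^ 2 + C a) ^ 2 ^ k :=
      Finset.sum_range_succ _ _
    have e1 : 2 * q + 2 - 2 ^ (k + 1) = (q + 1 - 2 ^ k) * 2 := by rw [pow_succ']; omega
    have e2 : 2 * q + 2 - 2 ^ k = (q + 1) + (q + 1 - 2 ^ k) := by omega
    rw [e2, pow_add] at ih
    rw [hs, CharTwo.add_sq, e1, pow_succ 2 k, pow_mul, pow_mul, mul_pow]
    linear_combination ih + (X : F[X]) ^ (q + 1) * X ^ (q + 1 - 2 ^ k) * (X ^ 2 + C a) ^ 2 ^ k *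
      (CharTwo.two_eq_zero (R := F[X]))

theorem X_sq_dvd_iteratedSquares {q : ℕ} (a : F) {k : ℕ} (hk : 2 ^ k ≤ q) :
    X ^ 2 ∣ iteratedSquares q a k := by
  refine Finset.dvd_sum fun i hi => Dvd.dvd.mul_right (pow_dvd_pow _ ?_) _
  have : 2 ^ (i + 1) ≤ 2 ^ k := Nat.pow_le_pow_right two_pos (Finset.mem_range.1 hi)
  have h1 : 1 ≤ 2 ^ i := Nat.one_le_two_pow
  rw [pow_succ'] at this
  omega

theorem degree_iteratedSquares {q : ℕ} (a : F) {k : ℕ} (hk : 2 ^ k ≤ q) :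
    (iteratedSquares q a k).degree < ((2 * q + 1 : ℕ) : WithBot ℕ) := by
  refine (degree_sum_le _ _).trans_lt ((Finset.sup_lt_iff (WithBot.bot_lt_coe _)).2 fun i hi => ?_)
  have : 2 ^ (i + 1) ≤ 2 ^ k := Nat.pow_le_pow_right two_pos (Finset.mem_range.1 hi)
  have h1 : 1 ≤ 2 ^ i := Nat.one_le_two_pow
  rw [pow_succ'] at this
  rw [degree_mul, degree_X_pow, degree_pow, degree_X_pow_add_C two_pos]
  rw [nsmul_eq_mul]
  norm_cast
  omega

theorem eval_iteratedSquares {q : ℕ} (a : F) {k : ℕ} (hk : 2 ^ k ≤ q) {c : F} (hc : c ≠ 0) :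
    (iteratedSquares q a k).eval c =
      c ^ (q + 1) * ∑ i ∈ Finset.range k, (c + a * c⁻¹) ^ 2 ^ i := by
  rw [iteratedSquares, eval_finsetSum, Finset.mul_sum]
  refine Finset.sum_congr rfl fun i hi => ?_
  have : 2 ^ i ≤ 2 ^ k := Nat.pow_le_pow_right two_pos (Finset.mem_range.1 hi).le
  have e : q + 1 = (q + 1 - 2 ^ i) + 2 ^ i := by omega
  conv_rhs => rw [e, pow_add, mul_assoc, ← mul_pow]
  simp
  left
  congr 1
  field_simp

/-- The numerator of the `x`-coordinate of the sum of the Frobenius point and `(X, 0)`. -/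
noncomputable def frobNumerator (q k : ℕ) (a : F) : F[X] :=
  (X ^ (q + 1) + C a) * (X ^ q + X) + iteratedSquares q a k

/-- The second factor on the left is the numerator belonging to P₀ - Q; the identity is the product
formula for the two x-coordinates, cleared of denominators. -/
theorem frobNumerator_mul [CharP F 2] {q k : ℕ} {a : F} (hk : 2 ^ k = q) (ha : a ^ q = a) :
    frobNumerator q k a * (frobNumerator q k a + X ^ (q + 1)) =
      ((X ^ (q + 1) + C a) * (X ^ q + X)) ^ 2 := by
  have h := iteratedSquares_artinSchreier a hk.le
  have e : 2 * q + 2 - q = q + 2 := by omega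
  rw [hk, e] at h
  have e' : (X ^ 2 + C a) ^ q = (X ^ q) ^ 2 + C a := by
    rw [← hk, add_pow_char_pow, hk, ← C_pow, ha, ← pow_mul, ← pow_mul, mul_comm]
  rw [e'] at h
  have two := CharTwo.two_eq_zero (R := F[X])
  unfold frobNumerator
  generalize iteratedSquares q a k = W at *
  have p1 : (X : F[X]) ^ (q + 1) = X ^ q * X := pow_succ _ _
  have p2 : (X : F[X]) ^ (q + 2) = X ^ q * X ^ 2 := pow_add _ _ _
  have p3 : (X : F[X]) ^ (2 * q + 1) = (X ^ q) ^ 2 * X := by ring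
  rw [p1, p2, p3] at h
  rw [p1]
  clear p1 p2 p3 e' e hk ha
  generalize (X : F[X]) ^ q = Y at *
  grind

theorem degree_frobNumerator {q k : ℕ} {a : F} (hk : 2 ^ k = q) (hq : 2 ≤ q) :
    (frobNumerator q k a).degree = ((2 * q + 1 : ℕ) : WithBot ℕ) := by
  have h : ((X ^ (q + 1) + C a) * (X ^ q + X) : F[X]).degree = ((2 * q + 1 : ℕ) : WithBot ℕ) := by
    rw [degree_mul, degree_X_pow_add_C (by omega), degree_add_eq_left_of_degree_lt, degree_X_pow]
    · norm_cast; omega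
    · rw [degree_X_pow, degree_X]; norm_cast
  rw [frobNumerator, degree_add_eq_left_of_degree_lt, h]
  rw [h]
  exact degree_iteratedSquares a hk.le

theorem X_dvd_frobNumerator {q k : ℕ} {a : F} (hk : 2 ^ k = q) (hq : 2 ≤ q) :
    X ∣ frobNumerator q k a := by
  refine dvd_add (Dvd.dvd.mul_left (dvd_add (dvd_pow_self _ (by omega)) dvd_rfl) _)
    (dvd_of_mul_right_dvd (pow_two (X : F[X]) ▸ X_sq_dvd_iteratedSquares a hk.le))

/-- Modulo X² only the term a X survives. -/
theorem not_X_sq_dvd_frobNumerator {q k : ℕ} {a : F} (ha : a ≠ 0) (hk : 2 ^ k = q) (hq : 2 ≤ q) :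
    ¬ X ^ 2 ∣ frobNumerator q k a := by
  intro h
  have h1 := (dvd_add_left (X_sq_dvd_iteratedSquares a hk.le)).1 h
  have := X_pow_dvd_iff.1 h1 1 one_lt_two
  obtain ⟨m, rfl⟩ : ∃ m, q = m + 2 := ⟨q - 2, by omega⟩
  have e : ((X ^ (m + 2 + 1) + C a) * (X ^ (m + 2) + X) : F[X]) =
    (X ^ (m + 1) * ((X ^ (m + 2 + 1) + C a) + X ^ 2) + C a) * X := by ring
  rw [e, coeff_mul_X, coeff_add, coeff_C_zero, mul_coeff_zero, coeff_X_pow] at this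
  simp at this
  exact ha this

/-- The denominator (X^q + X)² is the product of all (X - c)². At c = 0 the numerator has a simple
zero. At c ≠ 0 its value is c² times the trace of c + a/c, so nothing cancels unless c ∈ T. If c ∈
T, the other factor in `frobNumerator_mul` does not vanish at c, so the double zero of the product
falls entirely on the numerator. -/
theorem exists_frobNumerator_eq_mul [CharP F 2] [Fintype F] [DecidableEq F] {q k : ℕ} {a : F} (ha : a ≠ 0)
    (hk : 2 ^ k = q) (hq : 2 ≤ q) (hF : Fintype.card F = q) (T : Finset F)
    (hT : ∀ c, c ∈ T ↔ c ≠ 0 ∧ ∑ i ∈ Finset.range k, (c + a * c⁻¹) ^ 2 ^ i = 0) :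
    ∃ G f g : F[X], IsCoprime f g ∧ frobNumerator q k a = G * f ∧ (X ^ q + X) ^ 2 = G * g ∧
      G.natDegree = 1 + 2 * T.card := by
  have hpow (c : F) : c ^ q = c := by rw [← hF, FiniteField.pow_card]
  have hprod : (X ^ q + X : F[X]) = ∏ c : F, (X - C c) := by
    have := FiniteField.roots_X_pow_card_sub_X F
    rw [hF] at this
    rw [← CharTwo.sub_eq_add]
    have hdeg : (X ^ q - X : F[X]).natDegree = q := FiniteField.X_pow_card_sub_X_natDegree_eq F hq
    have hmonic : (X ^ q - X : F[X]).Monic := by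
      refine (monic_X_pow q).sub_of_left ?_
      rw [degree_X, degree_X_pow]
      exact_mod_cast hq
    rw [← prod_multiset_X_sub_C_of_monic_of_roots_card_eq hmonic, this, Finset.prod]
    rw [this, hdeg, ← hF]
    rfl
  have hevalN {c : F} (hc : c ≠ 0) : (frobNumerator q k a).eval c =
      c ^ 2 * ∑ i ∈ Finset.range k, (c + a * c⁻¹) ^ 2 ^ i := by
    rw [frobNumerator, eval_add, eval_iteratedSquares a hk.le hc, eval_mul]
    simp [hpow, CharTwo.add_self_eq_zero, pow_succ]
  have h0T : (0 : F) ∉ T := fun h => ((hT 0).1 h).1 rfl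
  have hTdvd (c : F) (hc : c ∈ T) : (X - C c) ^ 2 ∣ frobNumerator q k a := by
    obtain ⟨hc0, hcs⟩ := (hT c).1 hc
    have hN := frobNumerator_mul hk (hpow a)
    have hd : (X - C c) ^ 2 ∣ frobNumerator q k a * (frobNumerator q k a + X ^ (q + 1)) := by
      rw [hN]
      exact pow_dvd_pow_of_dvd (Dvd.dvd.mul_left
        (hprod ▸ Finset.dvd_prod_of_mem _ (Finset.mem_univ c)) _) 2
    refine IsCoprime.dvd_of_dvd_mul_right (IsCoprime.pow_left ?_) hd
    refine (irreducible_X_sub_C c).coprime_iff_not_dvd.2 fun h => ?_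
    rw [dvd_iff_isRoot, IsRoot.def, eval_add, hevalN hc0, hcs] at h
    simp [hc0] at h
  have hcop {c d : F} (hcd : c ≠ d) : IsCoprime (X - C c) (X - C d) :=
    isCoprime_X_sub_C_of_isUnit_sub (isUnit_iff_ne_zero.2 (sub_ne_zero.2 hcd))
  have hG : X * (∏ c ∈ T, (X - C c) ^ 2) ∣ frobNumerator q k a := by
    refine IsCoprime.mul_dvd ?_ (X_dvd_frobNumerator hk hq) ?_
    · refine IsCoprime.prod_right fun c hc => IsCoprime.pow_right ?_
      have := hcop (c := 0) (d := c) (fun h => h0T (h ▸ hc))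
      simpa using this
    · exact Finset.prod_dvd_of_coprime
        (fun c _ d _ hcd => IsCoprime.pow (hcop hcd)) hTdvd
  obtain ⟨f, hf⟩ := hG
  refine ⟨X * ∏ c ∈ T, (X - C c) ^ 2, f, X * ∏ c ∈ (Finset.univ.erase 0) \ T, (X - C c) ^ 2, ?_, hf,
    ?_, ?_⟩
  · refine IsCoprime.mul_right ?_ (IsCoprime.prod_right fun c hc => IsCoprime.pow_right ?_)
    · refine (irreducible_X.coprime_iff_not_dvd.2 fun h => ?_).symm
      refine not_X_sq_dvd_frobNumerator ha hk hq ?_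
      rw [hf, pow_two, mul_assoc]
      exact mul_dvd_mul_left _ (Dvd.dvd.mul_left h _)
    · refine ((irreducible_X_sub_C c).coprime_iff_not_dvd.2 fun h => ?_).symm
      simp only [Finset.mem_sdiff, Finset.mem_erase, Finset.mem_univ, and_true] at hc
      have hc' : (frobNumerator q k a).eval c = 0 := by
        rw [hf]
        exact dvd_iff_isRoot.1 (Dvd.dvd.mul_left h _)
      rw [hevalN hc.1] at hc'
      exact hc.2 ((hT c).2 ⟨hc.1, by simpa [hc.1] using hc'⟩)
  · have hsub : T ⊆ Finset.univ.erase 0 := fun c hc =>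
      Finset.mem_erase.2 ⟨((hT c).1 hc).1, Finset.mem_univ c⟩
    rw [hprod, ← Finset.mul_prod_erase _ _ (Finset.mem_univ 0), ← Finset.prod_sdiff hsub]
    simp only [Finset.prod_pow]
    rw [C_0, sub_zero]
    ring
  · have hne : ∏ c ∈ T, (X - C c) ^ 2 ≠ 0 :=
      Finset.prod_ne_zero_iff.2 fun c _ => pow_ne_zero 2 (X_sub_C_ne_zero c)
    rw [natDegree_X_mul hne, natDegree_prod _ _ fun c _ => pow_ne_zero 2 (X_sub_C_ne_zero c)]
    simp [natDegree_pow, add_comm, mul_comm]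

end Frobenius

/-! ### Manin's quadratic polynomial -/

section Hasse

open Polynomial WeierstrassCurve Affine

/-- The expression is the degree of the numerator of x(P₀ + nQ). By `degree_neighbors` its second
difference is 2, and its values at n = 0 and n = 1 are q and 2q - 2|T|. -/
theorem frobenius_quadratic_nonneg {F : Type*} [Field F] [CharP F 2] [Fintype F] [DecidableEq F]
    (K : Type*) [Field K] [Algebra F[X] K] [IsFractionRing F[X] K]
    {q k : ℕ} {a : F} (ha : a ≠ 0) (hk : 2 ^ k = q) (hq : 2 ≤ q) (hF : Fintype.card F = q)
    (T : Finset F)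
    (hT : ∀ c, c ∈ T ↔ c ≠ 0 ∧ ∑ i ∈ Finset.range k, (c + a * c⁻¹) ^ 2 ^ i = 0) (n : ℤ) :
    0 ≤ n ^ 2 + (q - 1 - 2 * T.card) * n + q := by
  classical
  have hinj := IsFractionRing.injective F[X] K
  have hKchar : CharP K 2 := charP_of_injective_algebraMap hinj 2
  have two : (2 : K) = 0 := CharTwo.two_eq_zero
  set t : K := algebraMap F[X] K X with htdef
  set b : K := algebraMap F[X] K (C a) with hbdef
  have ht : t ≠ 0 := by simp [htdef]
  have hb : b ≠ 0 := by simpa [hbdef] using ha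
  have hQ : (twistedCurve t b).Nonsingular t 0 := by
    refine twistedCurve_nonsingular hb ((twistedCurve_equation_iff _ _).2 ?_)
    field_simp
    grind
  have hapow : a ^ q = a := by rw [← hF, FiniteField.pow_card]
  have hW := iteratedSquares_artinSchreier a hk.le
  have hW' : (algebraMap F[X] K (iteratedSquares q a k)) ^ 2 +
      t ^ q * t * algebraMap F[X] K (iteratedSquares q a k) =
      t ^ q * t ^ 2 * ((t ^ q) ^ 2 + b) + (t ^ q) ^ 2 * t * (t ^ 2 + b) := by
    have e : 2 * q + 2 - q = q + 2 := by omega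
    have e' : (X ^ 2 + C a) ^ q = (X ^ q) ^ 2 + C a := by
      rw [← hk, add_pow_char_pow, hk, ← C_pow, hapow, ← pow_mul, ← pow_mul, mul_comm]
    rw [hk, e, e'] at hW
    have := congrArg (algebraMap F[X] K) hW
    simp only [map_add, map_mul, map_pow, ← htdef, ← hbdef] at this
    linear_combination this
  set w : K := algebraMap F[X] K (iteratedSquares q a k) with hwdef
  have hP : (twistedCurve t b).Nonsingular (t ^ q) (w / t) := by
    refine twistedCurve_nonsingular hb ((twistedCurve_equation_iff _ _).2 ?_)
    field_simp
    linear_combination hW'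
  obtain ⟨G, f₁, g₁, hfg₁, hN, hD, hGdeg⟩ := exists_frobNumerator_eq_mul ha hk hq hF T hT
  have hDne : (X ^ q + X : F[X]) ≠ 0 := by
    rw [← CharTwo.sub_eq_add]
    exact FiniteField.X_pow_card_sub_X_ne_zero F hq
  have hDK : t ^ q + t ≠ 0 := by
    have := hinj.ne hDne
    simpa using this
  have hGg : G * g₁ ≠ 0 := hD ▸ pow_ne_zero 2 hDne
  have hG0 := left_ne_zero_of_mul hGg
  have hg₁ := right_ne_zero_of_mul hGg
  let P : ℤ → (twistedCurve t b).Point := fun n => .some _ _ hP + n • .some _ _ hQ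
  have hPs (n : ℤ) : P (n + 1) = P n + .some _ _ hQ := by simp only [P]; module
  have hPp (n : ℤ) : P (n - 1) = P n - .some _ _ hQ := by simp only [P]; module
  choose f g hfg using fun n => exists_isReducedRep (F := F) (Point.xRep_ne_zero (P n))
  have h0 : IsReducedRep (P 0).xRep (X ^ q : F[X]) 1 := by
    refine ⟨isCoprime_one_right, 1, one_ne_zero, ?_⟩
    simp [P, htdef]
  have h1 : IsReducedRep (P 1).xRep f₁ g₁ := by
    have hne : t ^ q ≠ t := fun h => hDK (CharTwo.add_eq_zero.2 h)
    have hgK : algebraMap F[X] K g₁ ≠ 0 := by simpa using hinj.ne hg₁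
    have hGK : algebraMap F[X] K G ≠ 0 := by simpa using hinj.ne hG0
    refine ⟨hfg₁, (algebraMap F[X] K g₁)⁻¹, inv_ne_zero hgK, ?_, ?_⟩
    · simp only [P, one_smul]
      rw [Point.add_of_X_ne hne, Point.xRep_some, slope_of_X_ne hne]
      have hN' := congrArg (algebraMap F[X] K) hN
      have hD' := congrArg (algebraMap F[X] K) hD
      simp only [frobNumerator, map_add, map_mul, map_pow, ← htdef, ← hbdef, ← hwdef] at hN' hD'
      have hfrac : (algebraMap F[X] K g₁)⁻¹ * algebraMap F[X] K f₁ =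
          ((t ^ (q + 1) + b) * (t ^ q + t) + w) / (t ^ q + t) ^ 2 := by
        rw [hN', hD']
        field_simp
      rw [hfrac]
      simp only [addX, twistedCurve, Matrix.cons_val_zero, CharTwo.sub_eq_add]
      rw [pow_succ t q]
      generalize t ^ q = s at *
      field_simp
      grind
    · simp only [P, one_smul]
      rw [Point.add_of_X_ne hne, Point.xRep_some]
      simp [hgK]
  have hd0 : (f 0).natDegree = q ∧ (g 0).degree < (f 0).degree := by
    obtain ⟨e1, e2⟩ := (hfg 0).degree_eq h0
    rw [e1, e2, natDegree_eq_of_degree_eq e1, natDegree_X_pow, degree_X_pow, degree_one]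
    exact ⟨rfl, by norm_cast; omega⟩
  have hd1 : (f 1).natDegree + 2 * T.card = 2 * q ∧ (g 1).degree < (f 1).degree := by
    obtain ⟨e1, e2⟩ := (hfg 1).degree_eq h1
    have hNd := degree_frobNumerator (a := a) hk hq
    have hDd : ((X ^ q + X : F[X]) ^ 2).natDegree = 2 * q := by
      rw [natDegree_pow, ← CharTwo.sub_eq_add, FiniteField.X_pow_card_sub_X_natDegree_eq F hq]
    rw [hD, natDegree_mul hG0 hg₁] at hDd
    have hNd' := natDegree_eq_of_degree_eq_some hNd
    have hf₁ : f₁ ≠ 0 := by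
      rintro rfl
      rw [hN, mul_zero, degree_zero] at hNd
      exact absurd hNd.symm (WithBot.coe_ne_bot)
    rw [hN, natDegree_mul hG0 hf₁] at hNd'
    rw [e1, e2, natDegree_eq_of_degree_eq e1, degree_eq_natDegree hf₁, degree_eq_natDegree hg₁]
    exact ⟨by omega, by norm_cast; omega⟩
  have step (n : ℤ) (hn : (g n).degree < (f n).degree) :
      (f (n + 1)).natDegree + (f (n - 1)).natDegree = 2 * (f n).natDegree + 2 ∧
      ((g (n + 1)).degree < (f (n + 1)).degree ↔ (g (n - 1)).degree < (f (n - 1)).degree) := by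
    obtain ⟨u, hu, e1, e2⟩ := exists_unit_neighbors ha hQ (P n) (hfg n)
      (hPs n ▸ hfg (n + 1)) (hPp n ▸ hfg (n - 1))
    obtain ⟨h1, h2⟩ := degree_neighbors hu e1 e2 hn
    refine ⟨h1, h2, (degree_neighbors (a := a) hu ?_ ?_ hn).2⟩
    · rw [← e1]; ring
    · rw [← e2]; ring
  -- The recurrence has order two, so the induction, which runs in both directions, carries the data
  -- of two consecutive indices.
  have main (n : ℤ) : ((g n).degree < (f n).degree ∧ (g (n + 1)).degree < (f (n + 1)).degree) ∧
      ((f n).natDegree : ℤ) = n ^ 2 + (q - 1 - 2 * T.card) * n + q ∧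
      ((f (n + 1)).natDegree : ℤ) = (n + 1) ^ 2 + (q - 1 - 2 * T.card) * (n + 1) + q := by
    induction n using Int.induction_on with
    | zero =>
      refine ⟨⟨hd0.2, by simpa using hd1.2⟩, by simp [hd0.1], ?_⟩
      have := hd1.1
      rw [zero_add]
      zify at this
      linarith
    | succ n ih =>
      obtain ⟨⟨i1, i2⟩, i3, i4⟩ := ih
      obtain ⟨s1, s2⟩ := step _ i2
      rw [add_sub_cancel_right] at s1 s2
      refine ⟨⟨i2, s2.2 i1⟩, i4, ?_⟩
      zify at s1
      rw [i3, i4] at s1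
      linear_combination s1
    | pred n ih =>
      obtain ⟨⟨i1, i2⟩, i3, i4⟩ := ih
      obtain ⟨s1, s2⟩ := step _ i1
      rw [sub_add_cancel]
      refine ⟨⟨s2.1 i2, i1⟩, ?_, i3⟩
      zify at s1
      rw [i3, i4] at s1
      linear_combination s1
  rw [← (main n).2.1]
  positivity

end Hasse

/-! ### Trace, canonical character and Kloosterman sums -/

section Characters

variable (F : Type*) [Field F] [Algebra (ZMod 2) F]

theorem charP_two : CharP F 2 :=
  charP_of_injective_algebraMap (algebraMap (ZMod 2) F).injective 2

variable {F}

theorem tr_add (x y : F) : tr F (x + y) = tr F x + tr F y := map_add _ _ _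

theorem tr_zero : tr F 0 = 0 := map_zero _

theorem tr_eq_zero_or_one (x : F) : tr F x = 0 ∨ tr F x = 1 := by
  generalize tr F x = z
  revert z
  decide

theorem canonicalChar_add (x y : F) :
    canonicalChar F (x + y) = canonicalChar F x * canonicalChar F y := by
  unfold canonicalChar
  rw [tr_add]
  generalize tr F x = a
  generalize tr F y = b
  revert a b
  decide

theorem canonicalChar_zero : canonicalChar F 0 = 1 := by simp [canonicalChar, tr_zero]

theorem canonicalChar_eq_ite (x : F) : canonicalChar F x = 2 * (if tr F x = 0 then 1 else 0) - 1 := by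
  rcases tr_eq_zero_or_one x with h | h <;> simp [canonicalChar, h, ZMod.val_one]

variable (F) [Fintype F]

theorem card_eq_two_pow : Fintype.card F = 2 ^ Module.finrank (ZMod 2) F := by
  rw [Module.card_eq_pow_finrank (K := ZMod 2), ZMod.card]

variable {F}

theorem algebraMap_tr (x : F) :
    algebraMap (ZMod 2) F (tr F x) =
      ∑ i ∈ Finset.range (Module.finrank (ZMod 2) F), x ^ 2 ^ i := by
  have h := FiniteField.algebraMap_trace_eq_sum_pow (ZMod 2) F x
  rw [Nat.card_zmod] at h
  exact h

theorem tr_sq (x : F) : tr F (x ^ 2) = tr F x := by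
  have := charP_two F
  apply (algebraMap (ZMod 2) F).injective
  have h : (algebraMap (ZMod 2) F (tr F x)) ^ 2 = algebraMap (ZMod 2) F (tr F x) := by
    rw [← map_pow]
    congr 1
    generalize tr F x = z
    revert z
    decide
  rw [← h, algebraMap_tr, algebraMap_tr, CharTwo.sum_sq]
  exact Finset.sum_congr rfl fun i _ => by ring

theorem canonicalChar_sq (x : F) : canonicalChar F (x ^ 2) = canonicalChar F x := by
  rw [canonicalChar, canonicalChar, tr_sq]

theorem exists_tr_eq_one : ∃ x : F, tr F x = 1 :=
  Algebra.trace_surjective (ZMod 2) F 1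

theorem sum_canonicalChar : ∑ x : F, canonicalChar F x = 0 := by
  obtain ⟨e, he⟩ := exists_tr_eq_one (F := F)
  have h : ∑ x : F, canonicalChar F x = ∑ x : F, canonicalChar F (x + e) :=
    (Equiv.sum_comp (Equiv.addRight e) _).symm
  simp only [canonicalChar_add, ← Finset.sum_mul] at h
  have : canonicalChar F e = -1 := by simp [canonicalChar, he, ZMod.val_one]
  rw [this] at h
  linarith

theorem sum_canonicalChar_units [DecidableEq F] : ∑ x : Fˣ, canonicalChar F x = -1 := by
  have h := sum_canonicalChar (F := F)
  rw [← Finset.add_sum_erase _ _ (Finset.mem_univ 0), canonicalChar_zero] at h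
  have h2 : ∑ x ∈ Finset.univ.erase (0 : F), canonicalChar F x = ∑ x : Fˣ, canonicalChar F x := by
    refine (Finset.sum_bij (fun (x : Fˣ) _ => (x : F)) ?_ ?_ ?_ ?_).symm
    · simp
    · intro x _ y _ h; exact Units.ext h
    · intro b hb
      exact ⟨Units.mk0 b (Finset.ne_of_mem_erase hb), by simp, rfl⟩
    · simp
  linarith

/-- The equation `y² + y = c` has `1 + λ(c)` solutions. -/
theorem card_artinSchreier [DecidableEq F] (c : F) :
    (Finset.card {y : F | y ^ 2 + y = c} : ℤ) = 1 + canonicalChar F c := by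
  have := charP_two F
  have hle (c : F) : (Finset.card {y : F | y ^ 2 + y = c} : ℤ) ≤ 1 + canonicalChar F c := by
    by_cases hne : ({y : F | y ^ 2 + y = c} : Finset F).Nonempty
    · obtain ⟨y, hy⟩ := hne
      rw [Finset.mem_filter_univ] at hy
      have h1 : canonicalChar F c = 1 := by
        rw [← hy, canonicalChar_add, canonicalChar_sq, canonicalChar_eq_ite]
        split_ifs <;> norm_num
      have hsub : ({y : F | y ^ 2 + y = c} : Finset F) ⊆ {y, y + 1} := by
        intro z hz
        rw [Finset.mem_filter_univ] at hz
        rw [Finset.mem_insert, Finset.mem_singleton]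
        have : (z + y) * (z + (y + 1)) = 0 := by
          have two := CharTwo.two_eq_zero (R := F)
          linear_combination hz - hy + (z * y + y ^ 2 + y) * two
        rcases mul_eq_zero.1 this with h | h
        · exact Or.inl (CharTwo.add_eq_zero.1 h)
        · exact Or.inr (CharTwo.add_eq_zero.1 h)
      rw [h1]
      exact_mod_cast (Finset.card_le_card hsub).trans Finset.card_le_two
    · rw [Finset.not_nonempty_iff_eq_empty.1 hne, canonicalChar_eq_ite]
      split_ifs <;> norm_num
  -- Both sides of the pointwise bound `hle` sum to q over all c, so the bound is an equality
  -- everywhere.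
  have hsum : ∑ c : F, (Finset.card {y : F | y ^ 2 + y = c} : ℤ) =
      ∑ c : F, (1 + canonicalChar F c) := by
    rw [Finset.sum_add_distrib, sum_canonicalChar, ← Nat.cast_sum,
      ← Finset.card_eq_sum_card_fiberwise (fun _ _ => Finset.mem_coe.2 (Finset.mem_univ _))]
    simp
  exact (Finset.sum_eq_sum_iff_of_le fun c _ => hle c).1 hsum c (Finset.mem_univ c)

theorem exists_sq_eq (a : F) : ∃ c : F, c ^ 2 = a := by
  obtain ⟨c, hc⟩ := FiniteField.isSquare_of_char_two (CharP.eq (R := F) inferInstance (charP_two F)) a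
  exact ⟨c, by rw [hc, pow_two]⟩

variable [DecidableEq F]

/-- The nonzero elements `c` for which `c + a / c` has trace zero. -/
noncomputable def traceZeroSet (a : F) : Finset F := {c : F | c ≠ 0 ∧ tr F (c + a * c⁻¹) = 0}

theorem kloosterman_eq_card (a : F) :
    kloosterman F a = 2 * (traceZeroSet a).card - (Fintype.card F - 1) := by
  have h1 : (∑ α : Fˣ, if tr F ((α : F) + a * (α : F)⁻¹) = 0 then 1 else 0 : ℤ) =
      (traceZeroSet a).card := by
    rw [Finset.sum_boole, Nat.cast_inj]
    refine Finset.card_bij (fun (x : Fˣ) _ => (x : F)) ?_ ?_ ?_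
    · intro x hx
      simpa [traceZeroSet] using hx
    · intro x _ y _ h
      exact Units.ext h
    · intro b hb
      rw [traceZeroSet, Finset.mem_filter_univ] at hb
      exact ⟨Units.mk0 b hb.1, by simpa using hb.2, rfl⟩
  unfold kloosterman
  simp only [canonicalChar_eq_ite]
  rw [Finset.sum_sub_distrib, ← Finset.mul_sum, h1]
  have := Fintype.card_units F
  have h2 := Fintype.card_pos (α := F)
  simp
  omega

/-- The involution c ↦ a/c preserves the set. Its only fixed point is √a, which belongs to the set
because √a + a/√a = 0 in characteristic two. -/
theorem odd_card_traceZeroSet {a : F} (ha : a ≠ 0) : Odd (traceZeroSet a).card := by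
  have := charP_two F
  obtain ⟨s, hs⟩ := exists_sq_eq a
  have hs0 : s ≠ 0 := by rintro rfl; exact ha (by simpa using hs.symm)
  have hmem : s ∈ traceZeroSet a := by
    rw [traceZeroSet, Finset.mem_filter_univ]
    refine ⟨hs0, ?_⟩
    have : s + a * s⁻¹ = 0 := by
      rw [← hs, pow_two, mul_assoc, mul_inv_cancel₀ hs0, mul_one, CharTwo.add_self_eq_zero]
    rw [this, tr_zero]
  rw [← Finset.card_erase_add_one hmem]
  refine Even.add_one ?_
  rw [← ZMod.natCast_eq_zero_iff_even, Finset.card_eq_sum_ones, Nat.cast_sum]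
  refine Finset.sum_involution (fun c _ => a * c⁻¹) ?_ ?_ ?_ ?_
  · intro c _
    decide
  · intro c hc _ h
    rw [Finset.mem_erase, traceZeroSet, Finset.mem_filter_univ] at hc
    have hc0 := hc.2.1
    field_simp at h
    refine hc.1 (CharTwo.add_eq_zero.1 (pow_eq_zero_iff two_ne_zero |>.1 ?_))
    rw [CharTwo.add_sq, hs, h, CharTwo.add_self_eq_zero]
  · intro c hc
    rw [Finset.mem_erase, traceZeroSet, Finset.mem_filter_univ] at hc ⊢
    obtain ⟨hcs, hc0, hct⟩ := hc
    refine ⟨fun h => hcs ?_, mul_ne_zero ha (inv_ne_zero hc0), ?_⟩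
    · rw [← hs] at h
      field_simp at h
      exact h.symm
    · rw [← hct]
      congr 1
      field_simp
      ring
  · intro c hc
    field_simp

theorem kloosterman_modEq {a : F} (ha : a ≠ 0) (hq : 4 ≤ Fintype.card F) :
    kloosterman F a ≡ -1 [ZMOD 4] := by
  obtain ⟨m, hm⟩ := odd_card_traceZeroSet ha
  have h4 : 4 ∣ Fintype.card F := by
    rw [card_eq_two_pow] at hq ⊢
    exact pow_dvd_pow 2 ((Nat.pow_le_pow_iff_right (a := 2) one_lt_two (n := 2)).1 hq)
  rw [kloosterman_eq_card, hm]
  rw [Int.modEq_iff_dvd]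
  push_cast
  omega

/-- Hasse's bound for Kloosterman sums in characteristic two. -/
theorem kloosterman_sq_lt {a : F} (ha : a ≠ 0) (hq : 4 ≤ Fintype.card F) :
    kloosterman F a ^ 2 < 4 * Fintype.card F := by
  have := charP_two F
  have hmod := kloosterman_modEq ha hq
  have hK := kloosterman_eq_card a
  have hquad := frobenius_quadratic_nonneg (FractionRing (Polynomial F)) ha
    (card_eq_two_pow F).symm (by omega) rfl (traceZeroSet a) (fun c => by
      rw [traceZeroSet, Finset.mem_filter_univ, ← algebraMap_tr, map_eq_zero])
  obtain ⟨m, hm⟩ := (Int.modEq_iff_dvd.1 hmod)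
  -- The quadratic is n² - Kn + q with K = -1 - 4m, so -2m is an integer nearest to its minimum at
  -- K/2. It gives 2m(2m + 1) ≤ q, while K² = 4 · 2m(2m + 1) + 1; strictness is thus still needed.
  have hn := hquad (-(2 * m))
  have hKm : kloosterman F a = -1 - 4 * m := by linarith
  rw [hKm] at hK
  have h2 : (2 * (traceZeroSet a).card : ℤ) = Fintype.card F - 2 - 4 * m := by linarith
  rw [h2] at hn
  have hle : 2 * m * (2 * m + 1) ≤ Fintype.card F := by nlinarith
  -- As q is a power of two, its odd divisor 2m + 1 would be ±1, forcing q = 0 or q = 2.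
  have hne : 2 * m * (2 * m + 1) ≠ Fintype.card F := by
    intro h
    have hdvd : (2 * m + 1) ∣ (2 ^ Module.finrank (ZMod 2) F : ℤ) := by
      rw [card_eq_two_pow F] at h
      push_cast at h
      exact ⟨2 * m, by rw [← h]; ring⟩
    have hcop : IsCoprime (2 * m + 1) (2 ^ Module.finrank (ZMod 2) F : ℤ) :=
      IsCoprime.pow_right ⟨1, -m, by ring⟩
    rcases Int.isUnit_iff.1 (hcop.isUnit_of_dvd' dvd_rfl hdvd) with h' | h'
    · have : m = 0 := by omega
      subst this
      omega
    · have : m = -1 := by omega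
      subst this
      omega
  rw [hKm]
  have : 2 * m * (2 * m + 1) < Fintype.card F := lt_of_le_of_ne hle hne
  nlinarith

theorem kloosterman_mem_tauRange {a : F} (ha : a ≠ 0) (hq : 4 ≤ Fintype.card F) :
    kloosterman F a ∈ tauRange (Fintype.card F) := by
  rw [mem_tauRange]
  refine ⟨abs_lt_of_sq_lt_sq ?_ (by positivity), kloosterman_modEq ha hq⟩
  rw [mul_pow, Real.sq_sqrt (by positivity)]
  have := kloosterman_sq_lt ha hq
  have h : ((kloosterman F a ^ 2 : ℤ) : ℝ) < ((4 * Fintype.card F : ℤ) : ℝ) := by exact_mod_cast this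
  push_cast at h
  linarith

/-- Squaring permutes the units and preserves the absolute trace. -/
theorem kloosterman_sq (a : F) : kloosterman F (a ^ 2) = kloosterman F a := by
  have := charP_two F
  have hinj : Function.Injective (fun u : Fˣ => u ^ 2) := by
    intro u v h
    have h' : (u : F) ^ 2 = (v : F) ^ 2 := by simpa using congrArg Units.val h
    exact Units.ext (CharTwo.sq_injective h')
  unfold kloosterman
  rw [← Equiv.sum_comp (Equiv.ofBijective _ (Finite.injective_iff_bijective.1 hinj))]
  refine Finset.sum_congr rfl fun u _ => ?_
  rw [← canonicalChar_sq (u + a * (u : F)⁻¹ : F), CharTwo.add_sq]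
  simp [mul_pow]

end Characters

/-! ### Counting A with Tr A + Tr A⁻¹ = β in sizes 1 and 2 -/

section SmallMatrices

/-- The number of invertible matrices `A` with `Tr A + Tr A⁻¹ = β`. -/
noncomputable def traceInvCount (k : Type*) [Fintype k] [DecidableEq k] {F : Type*} [Field F] (β : F) : ℕ :=
  Nat.card {A : Matrix k k F // IsUnit A.det ∧ A.trace + A⁻¹.trace = β}

variable {F : Type*} [Field F] [Algebra (ZMod 2) F] [Fintype F] [DecidableEq F]

theorem card_sq_add_mul_eq {s : F} (hs : s ≠ 0) (d : F) :
    (Finset.card {a : F | a ^ 2 + s * a = d} : ℤ) = 1 + canonicalChar F (d / s ^ 2) := by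
  rw [← card_artinSchreier, Nat.cast_inj]
  refine Finset.card_equiv (Equiv.mulLeft₀ s⁻¹ (inv_ne_zero hs)) fun a => ?_
  rw [Finset.mem_filter_univ, Finset.mem_filter_univ, eq_div_iff (pow_ne_zero 2 hs)]
  have : ((s⁻¹ * a) ^ 2 + s⁻¹ * a) * s ^ 2 = a ^ 2 + s * a := by field_simp
  simp [this]

theorem card_sq_eq (d : F) : Finset.card {a : F | a ^ 2 = d} = 1 := by
  have := charP_two F
  obtain ⟨c, hc⟩ := exists_sq_eq d
  rw [Finset.card_eq_one]
  refine ⟨c, Finset.ext fun a => ?_⟩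
  rw [Finset.mem_filter_univ, Finset.mem_singleton, ← hc]
  exact CharTwo.sq_injective.eq_iff

/-- The equation x + x⁻¹ = β reads x² + βx = 1. For β ≠ 0, scaling by β makes it an Artin–Schreier
equation with constant β⁻², whose character value is that of β⁻¹; for β = 0 squaring is bijective.
-/
theorem traceInvCount_fin_one (β : F) :
    (traceInvCount (Fin 1) β : ℤ) = if β = 0 then 1 else 1 + canonicalChar F β⁻¹ := by
  have := charP_two F
  have h1 : traceInvCount (Fin 1) β = Finset.card {x : F | x ^ 2 + β * x = 1} := by
    rw [traceInvCount, ← Nat.subtype_card _ (fun x => Finset.mem_filter_univ x)]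
    refine Nat.card_congr ((Matrix.uniqueEquiv (m := Fin 1) (n := Fin 1)).subtypeEquiv fun A => ?_)
    simp only [Matrix.det_unique, isUnit_iff_ne_zero, Matrix.trace_fin_one, Matrix.inv_def,
      Matrix.adjugate_fin_one]
    simp [Matrix.uniqueEquiv]
    constructor
    · rintro ⟨h, rfl⟩
      field_simp
      grind
    · intro h
      have h0 : A 0 0 ≠ 0 := by intro h0; simp [h0] at h
      refine ⟨h0, ?_⟩
      field_simp
      grind
  rw [h1]
  split_ifs with hβ
  · simp only [hβ, zero_mul, add_zero, card_sq_eq, Nat.cast_one]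
  · rw [card_sq_add_mul_eq hβ, ← canonicalChar_sq β⁻¹]
    simp

theorem card_mul_eq {F : Type*} [Field F] [Fintype F] [DecidableEq F] (e : F) : (Finset.card {p : F × F | p.1 * p.2 = e} : ℤ) =
    Fintype.card F - 1 + if e = 0 then (Fintype.card F : ℤ) else 0 := by
  have h1 : Finset.card {p : F × F | p.1 * p.2 = e} =
      ∑ b : F, Finset.card {c : F | b * c = e} := by
    rw [Finset.card_eq_sum_card_fiberwise (f := Prod.fst) (t := Finset.univ) (by simp)]
    refine Finset.sum_congr rfl fun b _ => ?_
    refine Finset.card_bij (fun p _ => p.2) ?_ ?_ ?_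
    · rintro ⟨x, y⟩ h
      simp at h ⊢
      rw [← h.2, h.1]
    · rintro ⟨x, y⟩ hx ⟨x', y'⟩ hx' h
      simp at hx hx' h
      simp [hx.2, hx'.2, h]
    · intro c hc
      exact ⟨(b, c), by simpa using hc, rfl⟩
  rw [h1, ← Finset.add_sum_erase _ _ (Finset.mem_univ 0)]
  have h2 : ∑ b ∈ Finset.univ.erase (0 : F), Finset.card {c : F | b * c = e} =
      Fintype.card F - 1 := by
    rw [Finset.sum_congr rfl (g := fun _ => 1)]
    · simp
    · intro b hb
      rw [Finset.card_eq_one]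
      refine ⟨b⁻¹ * e, Finset.ext fun c => ?_⟩
      rw [Finset.mem_filter_univ, Finset.mem_singleton, eq_inv_mul_iff_mul_eq₀
        (Finset.ne_of_mem_erase hb)]
  rw [h2]
  have := Fintype.card_pos (α := F)
  push_cast [Nat.cast_sub this]
  split_ifs with he
  · subst he; simp; ring
  · simp [Ne.symm he]

/-- Fix the first diagonal entry a. The other is s + a, and the off-diagonal product must be e = a²
+ sa + d. There are q - 1 factorizations of e, and q more when e = 0, so the correction counts the
roots a of a quadratic. -/
theorem card_trace_det_eq (s d : F) :
    (Finset.card {A : Matrix (Fin 2) (Fin 2) F | A.trace = s ∧ A.det = d} : ℤ) =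
      (Fintype.card F : ℤ) ^ 2 +
        Fintype.card F * if s = 0 then 0 else canonicalChar F (d / s ^ 2) := by
  have := charP_two F
  have h1 : Finset.card {A : Matrix (Fin 2) (Fin 2) F | A.trace = s ∧ A.det = d} =
      ∑ a : F, Finset.card {p : F × F | p.1 * p.2 = a ^ 2 + s * a + d} := by
    rw [Finset.card_eq_sum_card_fiberwise (f := fun A => A 0 0) (t := Finset.univ) (by simp)]
    refine Finset.sum_congr rfl fun a _ => ?_
    refine Finset.card_bij (fun A _ => (A 0 1, A 1 0)) ?_ ?_ ?_
    · intro A hA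
      simp [Matrix.trace_fin_two, Matrix.det_fin_two] at hA ⊢
      obtain ⟨⟨rfl, rfl⟩, rfl⟩ := hA
      grind
    · intro A hA B hB h
      simp [Matrix.trace_fin_two, Matrix.det_fin_two] at hA hB h
      ext i j
      fin_cases i <;> fin_cases j <;> simp <;> grind
    · rintro ⟨b, c⟩ hbc
      refine ⟨!![a, b; c, s + a], ?_, rfl⟩
      simp [Matrix.trace_fin_two, Matrix.det_fin_two] at hbc ⊢
      grind
  rw [h1]
  push_cast
  simp only [card_mul_eq]
  rw [Finset.sum_add_distrib, Finset.sum_const, ← Finset.sum_filter, Finset.sum_const]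
  have h2 : (Finset.card {a : F | a ^ 2 + s * a + d = 0} : ℤ) =
      1 + if s = 0 then 0 else canonicalChar F (d / s ^ 2) := by
    simp only [CharTwo.add_eq_zero]
    split_ifs with hs
    · simp [hs, card_sq_eq]
    · exact card_sq_add_mul_eq hs d
  simp only [nsmul_eq_mul, h2, Finset.card_univ]
  ring

theorem traceInvCount_fin_two_eq_sum (β : F) :
    (traceInvCount (Fin 2) β : ℤ) = ∑ p : F × F with p.2 ≠ 0 ∧ p.1 + p.1 / p.2 = β,
      ((Fintype.card F : ℤ) ^ 2 +
        Fintype.card F * if p.1 = 0 then 0 else canonicalChar F (p.2 / p.1 ^ 2)) := by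
  have h1 : traceInvCount (Fin 2) β = Finset.card {A : Matrix (Fin 2) (Fin 2) F |
      A.det ≠ 0 ∧ A.trace + A.trace / A.det = β} := by
    rw [traceInvCount, ← Nat.subtype_card _ (fun x => Finset.mem_filter_univ x)]
    refine Nat.card_congr (Equiv.subtypeEquivRight fun A => ?_)
    rw [isUnit_iff_ne_zero]
    refine and_congr_right fun hA => ?_
    have : A⁻¹.trace = A.trace / A.det := by
      rw [Matrix.inv_def, Matrix.adjugate_fin_two, Matrix.trace_smul, Matrix.trace_fin_two,
        Matrix.trace_fin_two, Ring.inverse_eq_inv']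
      simp
      ring
    rw [this]
  rw [h1, Finset.card_eq_sum_card_fiberwise (f := fun A => (A.trace, A.det))
    (t := ({p : F × F | p.2 ≠ 0 ∧ p.1 + p.1 / p.2 = β} : Finset _)) (by intro A; simp)]
  push_cast
  refine Finset.sum_congr rfl fun p hp => ?_
  rw [← card_trace_det_eq, Nat.cast_inj]
  congr 1
  ext A
  rw [Finset.mem_filter_univ] at hp
  simp only [Finset.mem_filter, Finset.mem_univ, true_and, Prod.ext_iff]
  constructor
  · exact fun h => h.2
  · rintro ⟨h1, h2⟩
    rw [h1, h2]
    exact ⟨hp, rfl, rfl⟩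

/-- In size 2, Tr A⁻¹ = s/d for trace s and determinant d. As β ≠ 0, the condition s(1 + d⁻¹) = β
excludes d = 1 and determines s; then d/s² = (d + d⁻¹)/β², and summing over d gives a Kloosterman
sum without its term d = 1. -/
theorem traceInvCount_fin_two {β : F} (hβ : β ≠ 0) :
    (traceInvCount (Fin 2) β : ℤ) = (Fintype.card F : ℤ) ^ 3 - 2 * (Fintype.card F : ℤ) ^ 2 +
      Fintype.card F * kloosterman F β⁻¹ - Fintype.card F := by
  have := charP_two F
  have h1 : (traceInvCount (Fin 2) β : ℤ) = ∑ d ∈ Finset.univ.erase (1 : Fˣ),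
      ((Fintype.card F : ℤ) ^ 2 +
        Fintype.card F * canonicalChar F (((d : F) + (d : F)⁻¹) / β ^ 2)) := by
    rw [traceInvCount_fin_two_eq_sum]
    symm
    have hd (d : Fˣ) (hd : d ∈ Finset.univ.erase (1 : Fˣ)) : 1 + (d : F)⁻¹ ≠ 0 := by
      intro h
      apply Finset.ne_of_mem_erase hd
      have := CharTwo.add_eq_zero.1 h
      exact Units.ext (by simpa using this.symm)
    refine Finset.sum_bij (fun d _ => (β / (1 + (d : F)⁻¹), (d : F))) ?_ ?_ ?_ ?_
    · intro d hd'
      have := hd d hd'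
      rw [Finset.mem_filter_univ]
      refine ⟨d.ne_zero, ?_⟩
      have e : β / (1 + (d : F)⁻¹) + β / (1 + (d : F)⁻¹) / d =
        β / (1 + (d : F)⁻¹) * (1 + (d : F)⁻¹) := by ring
      simp only [e]
      rw [div_mul_cancel₀ _ this]
    · intro d _ d' _ h
      exact Units.ext (Prod.ext_iff.1 h).2
    · rintro ⟨s, d⟩ h
      rw [Finset.mem_filter_univ] at h
      obtain ⟨h0, hs⟩ := h
      simp only at h0 hs
      have h1 : 1 + d⁻¹ ≠ 0 := by
        intro h
        apply hβ
        rw [← hs]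
        linear_combination s * h
      refine ⟨Units.mk0 d h0, ?_, ?_⟩
      · rw [Finset.mem_erase]
        refine ⟨fun h => h1 ?_, Finset.mem_univ _⟩
        have : d = 1 := by simpa using congrArg Units.val h
        rw [this, inv_one, CharTwo.add_self_eq_zero]
      · simp only [Units.val_mk0, Prod.mk.injEq, and_true]
        rw [div_eq_iff h1, ← hs]
        ring
    · intro d hd'
      have h1 := hd d hd'
      simp only [div_eq_zero_iff, hβ, h1, or_self, if_false]
      congr 3
      have two := CharTwo.two_eq_zero (R := F)
      have hd0 := d.ne_zero
      field_simp
      grind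
  -- Replacing d by β²d gives the Kloosterman sum at β⁻⁴, which Frobenius invariance, used twice,
  -- brings back to β⁻¹.
  have h2 : ∑ d : Fˣ, canonicalChar F (((d : F) + (d : F)⁻¹) / β ^ 2) = kloosterman F β⁻¹ := by
    rw [← kloosterman_sq, ← kloosterman_sq, kloosterman,
      ← Equiv.sum_comp (Equiv.mulLeft ((Units.mk0 β hβ) ^ 2)) ]
    refine Finset.sum_congr rfl fun d _ => ?_
    congr 1
    simp
    field_simp
  have h3 := Finset.add_sum_erase Finset.univ (fun d : Fˣ => (Fintype.card F : ℤ) ^ 2 +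
        Fintype.card F * canonicalChar F (((d : F) + (d : F)⁻¹) / β ^ 2)) (Finset.mem_univ 1)
  rw [← h1, Finset.sum_add_distrib, ← Finset.mul_sum, h2, Finset.sum_const, Finset.card_univ,
    Fintype.card_units, nsmul_eq_mul, Nat.cast_sub Fintype.card_pos] at h3
  simp [CharTwo.add_self_eq_zero, canonicalChar_zero] at h3
  linarith

/-- The condition s(1 + d⁻¹) = 0 splits into s = 0 with d arbitrary, and s ≠ 0 with d = 1. -/
theorem traceInvCount_fin_two_zero :
    (traceInvCount (Fin 2) (0 : F) : ℤ) = 2 * (Fintype.card F : ℤ) ^ 3 -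
      2 * (Fintype.card F : ℤ) ^ 2 - Fintype.card F := by
  have := charP_two F
  rw [traceInvCount_fin_two_eq_sum, ← Finset.sum_filter_add_sum_filter_not _ (fun p => p.1 = 0)]
  have h1 : ∑ p ∈ ({p : F × F | p.2 ≠ 0 ∧ p.1 + p.1 / p.2 = 0} : Finset _) with p.1 = 0,
      ((Fintype.card F : ℤ) ^ 2 +
        Fintype.card F * if p.1 = 0 then 0 else canonicalChar F (p.2 / p.1 ^ 2)) =
      ∑ d : Fˣ, (Fintype.card F : ℤ) ^ 2 := by
    symm
    refine Finset.sum_bij (fun d _ => ((0 : F), (d : F))) ?_ ?_ ?_ ?_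
    · simp
    · intro d _ d' _ h
      exact Units.ext (Prod.ext_iff.1 h).2
    · rintro ⟨s, d⟩ h
      simp only [Finset.mem_filter, Finset.mem_univ, true_and] at h
      exact ⟨Units.mk0 d h.1.1, Finset.mem_univ _, by simp [h.2]⟩
    · simp
  have h2 : ∑ p ∈ ({p : F × F | p.2 ≠ 0 ∧ p.1 + p.1 / p.2 = 0} : Finset _) with ¬ p.1 = 0,
      ((Fintype.card F : ℤ) ^ 2 +
        Fintype.card F * if p.1 = 0 then 0 else canonicalChar F (p.2 / p.1 ^ 2)) =
      ∑ s : Fˣ, ((Fintype.card F : ℤ) ^ 2 + Fintype.card F * canonicalChar F s) := by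
    symm
    refine Finset.sum_bij (fun s _ => (((s⁻¹ : Fˣ) : F), (1 : F))) ?_ ?_ ?_ ?_
    · simp [CharTwo.add_self_eq_zero]
    · intro d _ d' _ h
      exact inv_injective (Units.ext (Prod.ext_iff.1 h).1)
    · rintro ⟨s, d⟩ h
      simp only [Finset.mem_filter, Finset.mem_univ, true_and] at h
      obtain ⟨⟨hd, hs⟩, hs0⟩ := h
      refine ⟨(Units.mk0 s hs0)⁻¹, Finset.mem_univ _, ?_⟩
      have := CharTwo.add_eq_zero.1 hs
      field_simp at this
      simp [this]
    · intro s _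
      rw [if_neg (Units.ne_zero _), ← canonicalChar_sq (s : F)]
      simp
  rw [h1, h2, Finset.sum_add_distrib, ← Finset.mul_sum, sum_canonicalChar_units]
  simp only [Finset.sum_const, Finset.card_univ, Fintype.card_units, nsmul_eq_mul]
  rw [Nat.cast_sub Fintype.card_pos]
  push_cast
  ring

end SmallMatrices

/-! ### From trace fibres to the weight distribution -/

section Weights

/-- The number of finite sets meeting every fibre of `τ` in a prescribed number of points. -/
theorem card_finset_fiber_card_eq {ι κ : Type*} [Fintype ι] [DecidableEq ι] [Fintype κ]
    [DecidableEq κ] (τ : ι → κ) (ν : κ → ℕ) :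
    Finset.card {T : Finset ι | (fun β => (T.filter (τ · = β)).card) = ν} =
      ∏ β, (Finset.card {i | τ i = β}).choose (ν β) := by
  simp only [← Finset.card_powersetCard]
  rw [← Fintype.card_piFinset]
  refine Finset.card_bij' (fun T _ β => T.filter (τ · = β))
    (fun s _ => Finset.univ.biUnion s) ?_ ?_ ?_ ?_
  · intro T hT
    rw [Finset.mem_filter_univ] at hT
    rw [Fintype.mem_piFinset]
    intro β
    rw [Finset.mem_powersetCard, ← hT]
    exact ⟨Finset.filter_subset_filter _ (Finset.subset_univ T), rfl⟩
  · intro s hs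
    rw [Fintype.mem_piFinset] at hs
    simp only [Finset.mem_powersetCard] at hs
    rw [Finset.mem_filter_univ]
    ext β
    rw [← (hs β).2]
    congr 1
    ext i
    simp only [Finset.mem_filter, Finset.mem_biUnion, Finset.mem_univ, true_and]
    constructor
    · rintro ⟨⟨γ, hγ⟩, rfl⟩
      have := (Finset.mem_filter.1 ((hs γ).1 hγ)).2
      rwa [this]
    · exact fun h => ⟨⟨β, h⟩, (Finset.mem_filter.1 ((hs β).1 h)).2⟩
  · intro T _
    ext i
    simp
  · intro s hs
    rw [Fintype.mem_piFinset] at hs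
    simp only [Finset.mem_powersetCard] at hs
    ext β i
    simp only [Finset.mem_filter, Finset.mem_biUnion, Finset.mem_univ, true_and]
    constructor
    · rintro ⟨⟨γ, hγ⟩, rfl⟩
      have := (Finset.mem_filter.1 ((hs γ).1 hγ)).2
      rwa [this]
    · exact fun h => ⟨⟨β, h⟩, (Finset.mem_filter.1 ((hs β).1 h)).2⟩

/-- Binary words correspond to their supports. -/
def supportEquiv (ι : Type*) [Fintype ι] [DecidableEq ι] : (ι → ZMod 2) ≃ Finset ι where
  toFun u := {i | u i ≠ 0}
  invFun T i := if i ∈ T then 1 else 0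
  left_inv u := by
    ext i
    simp only [Finset.mem_filter_univ]
    generalize u i = z
    revert z
    decide
  right_inv T := by
    ext i
    simp

/-- A word is its support T. Both |T| and the sum of the traces over T are functions of the numbers
of points of T in the trace fibres. -/
theorem weightCount_traceCode {F : Type*} [Field F] [Fintype F] [DecidableEq F]
    [Algebra (ZMod 2) F] {m : Type*} [Fintype m] {S : Set (Matrix m m F)} {N : ℕ}
    (g : Fin N ≃ S) (j : ℕ) :
    weightCount (traceCode g) j = ∑ ν ∈ families F j,
      ∏ β, (Nat.card {w : S // (w : Matrix m m F).trace = β}).choose (ν β) := by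
  set τ : Fin N → F := fun i => (g i : Matrix m m F).trace with hτ
  have hN (β : F) : Nat.card {w : S // (w : Matrix m m F).trace = β} =
      Finset.card {i | τ i = β} := by
    rw [← Nat.subtype_card _ (fun x => Finset.mem_filter_univ x)]
    exact (Nat.card_congr (g.subtypeEquiv fun i => Iff.rfl)).symm
  simp only [hN, ← card_finset_fiber_card_eq]
  have h1 : weightCount (traceCode g) j =
      Finset.card {T : Finset (Fin N) | T.card = j ∧ ∑ i ∈ T, τ i = 0} := by
    rw [weightCount, ← Nat.subtype_card _ (fun x => Finset.mem_filter_univ x)]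
    refine Nat.card_congr ((supportEquiv _).subtypeEquiv fun u => ?_)
    rw [and_comm]
    refine and_congr Iff.rfl ?_
    change ∑ i, algebraMap (ZMod 2) F (u i) * τ i = 0 ↔ ∑ i ∈ {i | u i ≠ 0}, τ i = 0
    rw [Finset.sum_filter]
    refine Eq.congr (Finset.sum_congr rfl fun i _ => ?_) rfl
    generalize u i = z
    obtain rfl | rfl : z = 0 ∨ z = 1 := by revert z; decide
    · simp
    · simp
  have hcard (T : Finset (Fin N)) : ∑ β, (T.filter (τ · = β)).card = T.card :=
    (Finset.card_eq_sum_card_fiberwise fun _ _ => Finset.mem_coe.2 (Finset.mem_univ _)).symm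
  have hsum (T : Finset (Fin N)) : ∑ β, ((T.filter (τ · = β)).card : F) * β = ∑ i ∈ T, τ i := by
    rw [← Finset.sum_fiberwise T τ τ]
    refine Finset.sum_congr rfl fun β _ => ?_
    rw [Finset.sum_congr rfl (g := fun _ => β) fun i hi => (Finset.mem_filter.1 hi).2]
    simp
  rw [h1, Finset.card_eq_sum_card_fiberwise
    (f := fun (T : Finset (Fin N)) β => (T.filter (τ · = β)).card) (t := families F j)]
  · refine Finset.sum_congr rfl fun ν hν => ?_
    congr 1
    ext T
    rw [mem_families] at hν
    simp only [Finset.mem_filter, Finset.mem_univ, true_and, and_iff_right_iff_imp]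
    rintro rfl
    rw [hcard, hsum] at hν
    exact hν
  · intro T hT
    rw [Finset.mem_coe, Finset.mem_filter_univ] at hT
    rw [Finset.mem_coe, mem_families, hcard, hsum]
    exact hT

end Weights

/-! ### Counting invertible alternating matrices -/

section Alternating

open Matrix

variable {F : Type*} [Field F] {l m : Type*}

/-- Alternating matrices. -/
def IsAlternating (M : Matrix l l F) : Prop := Mᵀ = -M ∧ ∀ i, M i i = 0

theorem IsAlternating.dotProduct_mulVec [Fintype l] {M : Matrix l l F} (h : IsAlternating M)
    (x : l → F) : x ⬝ᵥ M *ᵥ x = 0 := by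
  classical
  have e : x ⬝ᵥ M *ᵥ x = ∑ p : l × l, x p.1 * (M p.1 p.2 * x p.2) := by
    rw [Fintype.sum_prod_type]
    simp [dotProduct, mulVec, Finset.mul_sum]
  rw [e]
  refine Finset.sum_involution (fun p _ => p.swap) ?_ ?_ ?_ ?_
  · intro p _
    have := congrFun (congrFun h.1 p.1) p.2
    rw [transpose_apply, neg_apply] at this
    simp only [Prod.fst_swap, Prod.snd_swap, this]
    ring
  · rintro ⟨i, j⟩ _ hne heq
    obtain rfl : j = i := (Prod.ext_iff.1 heq).1
    simp [h.2] at hne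
  · simp
  · simp

theorem IsAlternating.transpose_mul_mul [Fintype l] {M : Matrix l l F} (h : IsAlternating M)
    (P : Matrix l m F) : IsAlternating (Pᵀ * M * P) := by
  refine ⟨by simp [h.1, Matrix.mul_assoc], fun i => ?_⟩
  rw [← h.dotProduct_mulVec (P.col i)]
  simp only [mul_apply, dotProduct, mulVec, Finset.mul_sum, Finset.sum_mul, transpose_apply, col_apply]
  rw [Finset.sum_comm]
  simp [mul_assoc]

theorem IsAlternating.reindex {M : Matrix l l F} (e : l ≃ m) :
    IsAlternating (Matrix.reindex e e M) ↔ IsAlternating M := by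
  constructor
  · rintro ⟨h1, h2⟩
    refine ⟨?_, fun i => by simpa using h2 (e i)⟩
    ext i j
    simpa using congrFun (congrFun h1 (e i)) (e j)
  · rintro ⟨h1, h2⟩
    refine ⟨?_, fun i => by simpa using h2 (e.symm i)⟩
    ext i j
    simpa using congrFun (congrFun h1 (e.symm i)) (e.symm j)

/-- The matrix `[0, v; -vᵀ, X]`. -/
def border (v : l → F) (X : Matrix l l F) : Matrix (Unit ⊕ l) (Unit ⊕ l) F :=
  fromBlocks 0 (replicateRow Unit v) (-replicateCol Unit v) X

theorem isAlternating_border {v : l → F} {X : Matrix l l F} :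
    IsAlternating (border v X) ↔ IsAlternating X := by
  constructor
  · rintro ⟨h1, h2⟩
    refine ⟨?_, fun i => by simpa [border] using h2 (Sum.inr i)⟩
    ext i j
    simpa [border] using congrFun (congrFun h1 (Sum.inr i)) (Sum.inr j)
  · rintro ⟨h1, h2⟩
    refine ⟨?_, ?_⟩
    · rw [border, fromBlocks_transpose, fromBlocks_neg, h1]
      congr 1 <;> ext <;> simp
    · rintro (i | i) <;> simp [border, h2]

theorem exists_eq_border {M : Matrix (Unit ⊕ l) (Unit ⊕ l) F} (h : IsAlternating M) :
    border (fun j => M (Sum.inl ()) (Sum.inr j)) M.toBlocks₂₂ = M := by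
  ext (i | i) (j | j)
  · simp [border, h.2]
  · simp [border]
  · have := congrFun (congrFun h.1 (Sum.inr i)) (Sum.inl ())
    simp [border] at this ⊢
    rw [this, neg_neg]
  · simp [border, toBlocks₂₂]

variable [Fintype l] [DecidableEq l] [Fintype m] [DecidableEq m]

/-- The number of invertible alternating matrices. -/
noncomputable def alternatingCount (l F : Type*) [Field F] [Fintype l] [DecidableEq l] : ℕ :=
  Nat.card {M : Matrix l l F // IsAlternating M ∧ IsUnit M.det}

theorem alternatingCount_congr (e : l ≃ m) : alternatingCount l F = alternatingCount m F :=
  Nat.card_congr ((Matrix.reindex e e).subtypeEquiv fun M => by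
    rw [IsAlternating.reindex, det_reindex_self])

/-- The isomorphism between the lines spanned by v and w extends to an automorphism of the whole
space. -/
theorem exists_vecMul_eq {v w : l → F} (hv : v ≠ 0) (hw : w ≠ 0) :
    ∃ P : Matrix l l F, IsUnit P.det ∧ v ᵥ* P = w := by
  obtain ⟨g, hg⟩ := Submodule.exists_linearEquiv_restrict_eq
    ((LinearEquiv.toSpanNonzeroSingleton F _ v hv).symm.trans
      (LinearEquiv.toSpanNonzeroSingleton F _ w hw))
  refine ⟨(LinearMap.toMatrix' (g : (l → F) →ₗ[F] (l → F)))ᵀ, ?_, ?_⟩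
  · rw [det_transpose, LinearMap.det_toMatrix']
    exact g.isUnit_det'
  · rw [vecMul_transpose, LinearMap.toMatrix'_mulVec]
    have := hg ⟨v, Submodule.mem_span_singleton_self v⟩
    have hv1 : (LinearEquiv.toSpanNonzeroSingleton F _ v hv).symm
        ⟨v, Submodule.mem_span_singleton_self v⟩ = 1 := by
      rw [LinearEquiv.symm_apply_eq, LinearEquiv.toSpanNonzeroSingleton_one]
    rw [LinearEquiv.trans_apply, hv1, LinearEquiv.toSpanNonzeroSingleton_one] at this
    exact this.symm

/-- Congruence by an invertible matrix. -/
noncomputable def congruenceEquiv (P : Matrix l l F) (hP : IsUnit P.det) : Matrix l l F ≃ Matrix l l F where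
  toFun X := Pᵀ * X * P
  invFun X := P⁻¹ᵀ * X * P⁻¹
  left_inv X := by
    have h1 : P⁻¹ᵀ * Pᵀ = 1 := by rw [← transpose_mul, mul_nonsing_inv _ hP, transpose_one]
    calc P⁻¹ᵀ * (Pᵀ * X * P) * P⁻¹ = (P⁻¹ᵀ * Pᵀ) * X * (P * P⁻¹) := by simp only [Matrix.mul_assoc]
      _ = X := by rw [h1, mul_nonsing_inv _ hP, one_mul, mul_one]
  right_inv X := by
    have h1 : Pᵀ * P⁻¹ᵀ = 1 := by rw [← transpose_mul, nonsing_inv_mul _ hP, transpose_one]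
    calc Pᵀ * (P⁻¹ᵀ * X * P⁻¹) * P = (Pᵀ * P⁻¹ᵀ) * X * (P⁻¹ * P) := by simp only [Matrix.mul_assoc]
      _ = X := by rw [h1, nonsing_inv_mul _ hP, one_mul, mul_one]

theorem isAlternating_congruenceEquiv (P : Matrix l l F) (hP : IsUnit P.det) (X : Matrix l l F) :
    IsAlternating (congruenceEquiv P hP X) ↔ IsAlternating X := by
  refine ⟨fun h => ?_, fun h => h.transpose_mul_mul P⟩
  rw [← (congruenceEquiv P hP).symm_apply_apply X]
  exact h.transpose_mul_mul P⁻¹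

/-- The number of alternating `X` for which `[0, v; -vᵀ, X]` is invertible. -/
noncomputable def borderCount (v : l → F) : ℕ :=
  Nat.card {X : Matrix l l F // IsAlternating X ∧ IsUnit (border v X).det}

/-- Congruence by diag(1, P) carries the border v of X to the border vP of PᵀXP. Hence all nonzero
first rows contribute equally. -/
theorem borderCount_vecMul (v : l → F) (P : Matrix l l F) (hP : IsUnit P.det) :
    borderCount (v ᵥ* P) = borderCount v := by
  refine (Nat.card_congr ((congruenceEquiv P hP).subtypeEquiv fun X => ?_)).symm
  rw [isAlternating_congruenceEquiv]
  refine and_congr_right fun _ => ?_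
  have : border (v ᵥ* P) (congruenceEquiv P hP X) =
      (fromBlocks 1 0 0 P)ᵀ * border v X * fromBlocks 1 0 0 P := by
    rw [border, border, fromBlocks_transpose, fromBlocks_multiply, fromBlocks_multiply]
    congr 1
    · simp
    · simp [replicateRow_vecMul]
    · simp [← mulVec_transpose, replicateCol_mulVec]
    · simp [congruenceEquiv]
  rw [this, det_mul, det_mul, det_transpose, det_fromBlocks_zero₂₁, det_one, one_mul]
  rw [IsUnit.mul_iff, IsUnit.mul_iff]
  simp only [hP, and_true, true_and]

theorem borderCount_zero : borderCount (0 : l → F) = 0 := by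
  rw [borderCount, Nat.card_eq_zero]
  refine Or.inl ⟨fun X => ?_⟩
  have : (border (0 : l → F) X.1).det = 0 := det_eq_zero_of_row_eq_zero (Sum.inl ()) (by
    rintro (j | j) <;> simp [border])
  exact X.2.2.ne_zero this

theorem alternatingCount_unit_sum [Fintype F] :
    alternatingCount (Unit ⊕ l) F = ∑ v : l → F, borderCount v := by
  simp only [borderCount, alternatingCount]
  rw [← Nat.card_sigma]
  refine Nat.card_congr
    { toFun := fun M => ⟨fun j => M.1 (Sum.inl ()) (Sum.inr j), M.1.toBlocks₂₂, ?_, ?_⟩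
      invFun := fun X => ⟨border X.1 X.2.1, isAlternating_border.2 X.2.2.1, X.2.2.2⟩
      left_inv := fun M => Subtype.ext (exists_eq_border M.2.1)
      right_inv := fun X => ?_ }
  · have := exists_eq_border M.2.1
    rw [← isAlternating_border, this]
    exact M.2.1
  · rw [exists_eq_border M.2.1]
    exact M.2.2
  · rfl

/-- The leading 2 × 2 block J is a hyperbolic plane. Row operations clear what lies below it, and
they leave Y unchanged because the first row is zero beyond J. -/
theorem isUnit_det_border_border (u : m → F) (Y : Matrix m m F) :
    IsUnit (border (Sum.elim 1 0) (border u Y)).det ↔ IsUnit Y.det := by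
  let J : Matrix (Unit ⊕ Unit) (Unit ⊕ Unit) F := fromBlocks 0 1 (-1) 0
  let R : Matrix (Unit ⊕ Unit) m F := fromRows 0 (replicateRow Unit u)
  have h1 : Matrix.reindex (Equiv.sumAssoc Unit Unit m).symm (Equiv.sumAssoc Unit Unit m).symm
      (border (Sum.elim 1 0) (border u Y)) = fromBlocks J R (-Rᵀ) Y := by
    ext ((i | i) | i) ((j | j) | j) <;> simp [border, J, R]
  have h2 : fromBlocks (1 : Matrix (Unit ⊕ Unit) (Unit ⊕ Unit) F) 0
      (fromCols (replicateCol Unit u) 0) (1 : Matrix m m F) * fromBlocks J R (-Rᵀ) Y =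
      fromBlocks J R 0 Y := by
    rw [fromBlocks_multiply]
    congr 1
    · simp
    · simp
    · ext i (j | j) <;> simp [J, R, fromCols_mul_fromBlocks]
    · simp [R, fromCols_mul_fromRows]
  have h3 := congrArg det h2
  rw [det_mul, det_fromBlocks_zero₁₂, det_fromBlocks_zero₂₁, det_one, det_one, one_mul, one_mul,
    ← h1, det_reindex_self] at h3
  have hJ : IsUnit J.det := by
    refine isUnit_det_of_right_inverse (B := -J) ?_
    simp [J, fromBlocks_multiply, fromBlocks_neg]
  rw [h3, IsUnit.mul_iff, and_iff_right hJ]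

theorem borderCount_elim [Fintype F] :
    borderCount (Sum.elim 1 0 : Unit ⊕ m → F) =
      Fintype.card F ^ Fintype.card m * alternatingCount m F := by
  rw [← Fintype.card_fun, ← Nat.card_eq_fintype_card, alternatingCount, ← Nat.card_prod, borderCount]
  refine Nat.card_congr
    { toFun := fun M => ⟨fun j => M.1 (Sum.inl ()) (Sum.inr j), M.1.toBlocks₂₂, ?_, ?_⟩
      invFun := fun X => ⟨border X.1 X.2.1, isAlternating_border.2 X.2.2.1, ?_⟩
      left_inv := fun M => Subtype.ext (exists_eq_border M.2.1)
      right_inv := fun X => ?_ }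
  · have := exists_eq_border M.2.1
    rw [← isAlternating_border, this]
    exact M.2.1
  · have := M.2.2
    rw [← exists_eq_border M.2.1, isUnit_det_border_border] at this
    exact this
  · rw [isUnit_det_border_border]
    exact X.2.2.2
  · rfl

/-- The first row is one of q^(m+1) - 1 nonzero vectors, all equivalent to (1, 0). For that row the
second border is free and the remaining block is any invertible alternating matrix. -/
theorem alternatingCount_unit_sum_unit_sum [Fintype F] [DecidableEq F] :
    alternatingCount (Unit ⊕ (Unit ⊕ m)) F =
      (Fintype.card F ^ (Fintype.card m + 1) - 1) *
        (Fintype.card F ^ Fintype.card m * alternatingCount m F) := by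
  rw [alternatingCount_unit_sum, ← Finset.add_sum_erase _ _ (Finset.mem_univ 0), borderCount_zero,
    zero_add, ← borderCount_elim]
  have hne : (Sum.elim 1 0 : Unit ⊕ m → F) ≠ 0 := fun h => by
    simpa using congrFun h (Sum.inl ())
  rw [Finset.sum_congr rfl (g := fun _ => borderCount (Sum.elim 1 0 : Unit ⊕ m → F)) fun v hv => ?_,
    Finset.sum_const, Finset.card_erase_of_mem (Finset.mem_univ _), Finset.card_univ,
    Fintype.card_fun, Fintype.card_sum, Fintype.card_unit, add_comm 1, smul_eq_mul]
  obtain ⟨P, hP, hPv⟩ := exists_vecMul_eq hne (Finset.ne_of_mem_erase hv)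
  rw [← hPv, borderCount_vecMul _ _ hP]

theorem alternatingCount_fin [Fintype F] [DecidableEq F] (k : ℕ) :
    (alternatingCount (Fin (2 * k)) F : ℚ) = (Fintype.card F : ℚ) ^ (k * (k - 1)) *
      ∏ j ∈ Finset.Icc 1 k, ((Fintype.card F : ℚ) ^ (2 * j - 1) - 1) := by
  have hq := Fintype.card_pos (α := F)
  induction k with
  | zero =>
    have hs : Subsingleton {M : Matrix (Fin 0) (Fin 0) F // IsAlternating M ∧ IsUnit M.det} :=
      inferInstance
    have hne : Nonempty {M : Matrix (Fin 0) (Fin 0) F // IsAlternating M ∧ IsUnit M.det} :=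
      ⟨⟨0, ⟨Subsingleton.elim _ _, fun i => isEmptyElim i⟩, by simp⟩⟩
    have : alternatingCount (Fin (2 * 0)) F = 1 := Nat.card_eq_one_iff_unique.2 ⟨hs, hne⟩
    simp [this]
  | succ k ih =>
    have e : Fin (2 * (k + 1)) ≃ Unit ⊕ (Unit ⊕ Fin (2 * k)) :=
      Fintype.equivOfCardEq (by simp; ring)
    have e1 : 2 * (k + 1) - 1 = 2 * k + 1 := by omega
    have e2 : (k + 1) * (k + 1 - 1) = 2 * k + k * (k - 1) := by
      rcases k with _ | k
      · rfl
      · simp only [Nat.add_sub_cancel]; ring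
    rw [alternatingCount_congr e, alternatingCount_unit_sum_unit_sum, Fintype.card_fin,
      Nat.cast_mul, Nat.cast_sub (Nat.one_le_pow (2 * k + 1) _ hq), Nat.cast_mul, ih,
      Finset.prod_Icc_succ_top (by omega), e1, e2, pow_add]
    push_cast
    ring

theorem alternatingCount_eq [Fintype F] [DecidableEq F] {k : ℕ} (hl : Fintype.card l = 2 * k) :
    (alternatingCount l F : ℚ) = (Fintype.card F : ℚ) ^ (k * (k - 1)) *
      ∏ j ∈ Finset.Icc 1 k, ((Fintype.card F : ℚ) ^ (2 * j - 1) - 1) := by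
  rw [← alternatingCount_fin, alternatingCount_congr (Fintype.equivOfCardEq (β := Fin (2 * k)) (by simpa using hl))]

end Alternating

/-! ### Counting a class function on a double coset -/

section DoubleCosets

/-- Both sides count pairs (p, p') in P × P with f(p s p') = β. Over a fixed w = p s p' the pairs
form a torsor under P ∩ sPs⁻¹. On the other side f(p s p') = f(p' p s), and (p, p') ↦ (p', p' p)
separates the variables. -/
theorem card_doubleCoset_mul_card {G : Type*} [Group G] (P : Subgroup G) (s : G) {X : Type*}
    (f : G → X) (hf : ∀ a b, f (a * b) = f (b * a)) (β : X) :
    Nat.card {w // w ∈ DoubleCoset.doubleCoset s (P : Set G) P ∧ f w = β} *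
        Nat.card {p : P // s⁻¹ * p * s ∈ P} =
      Nat.card P * Nat.card {p : P // f (p * s) = β} := by
  rw [← Nat.card_prod, ← Nat.card_prod]
  trans Nat.card {x : P × P // f (x.1 * s * x.2) = β}
  · have hex (w : {w // w ∈ DoubleCoset.doubleCoset s (P : Set G) P ∧ f w = β}) :
        ∃ a b : P, (w : G) = a * s * b := by
      obtain ⟨a, ha, b, hb, h⟩ := DoubleCoset.mem_doubleCoset.1 w.2.1
      exact ⟨⟨a, ha⟩, ⟨b, hb⟩, h⟩
    choose a b hab using hex
    have hmem (h : {p : P // s⁻¹ * p * s ∈ P}) : s⁻¹ * (h.1 : G)⁻¹ * s ∈ P := by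
      have := P.inv_mem h.2
      simpa only [mul_inv_rev, inv_inv, mul_assoc] using this
    have hprod (w) (h : {p : P // s⁻¹ * p * s ∈ P}) :
        ((a w * h.1 : P) : G) * s * ((⟨_, hmem h⟩ * b w : P) : G) = w := by
      rw [hab w]
      simp only [Subgroup.coe_mul]
      group
    refine Nat.card_congr (Equiv.ofBijective
      (fun x => ⟨(a x.1 * x.2.1, ⟨_, hmem x.2⟩ * b x.1), by rw [hprod]; exact x.1.2.2⟩) ⟨?_, ?_⟩)
    · rintro ⟨w, h⟩ ⟨w', h'⟩ heq
      rw [Subtype.mk.injEq, Prod.mk.injEq] at heq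
      obtain rfl : w = w' := by
        ext1
        rw [← hprod w h, ← hprod w' h', heq.1, heq.2]
      obtain rfl : h = h' := Subtype.ext (mul_left_cancel heq.1)
      rfl
    · rintro ⟨⟨p, p'⟩, hp⟩
      let w : {w // w ∈ DoubleCoset.doubleCoset s (P : Set G) P ∧ f w = β} :=
        ⟨p * s * p', DoubleCoset.mem_doubleCoset.2 ⟨p, p.2, p', p'.2, rfl⟩, hp⟩
      have hw : (p : G) * s * p' = a w * s * b w := hab w
      have hconj : s⁻¹ * ((a w)⁻¹ * p : P) * s = (b w * p'⁻¹ : P) := by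
        have : (p : G) * s = a w * s * b w * (p' : G)⁻¹ := by rw [← hw]; group
        simp only [Subgroup.coe_mul, Subgroup.coe_inv]
        rw [mul_assoc, mul_assoc, this]
        group
      refine ⟨(w, ⟨(a w)⁻¹ * p, hconj ▸ SetLike.coe_mem _⟩), ?_⟩
      refine Subtype.ext (Prod.ext (by simp) ?_)
      ext1
      have hinv (x : G) : s⁻¹ * x⁻¹ * s = (s⁻¹ * x * s)⁻¹ := by group
      change s⁻¹ * (((a w)⁻¹ * p : P) : G)⁻¹ * s * (b w : G) = p'
      rw [hinv, hconj, Subgroup.coe_mul, Subgroup.coe_inv]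
      group
  · refine Nat.card_congr
      { toFun := fun x => (x.1.2, ⟨x.1.2 * x.1.1, ?_⟩)
        invFun := fun x => ⟨(x.1⁻¹ * x.2.1, x.1), ?_⟩
        left_inv := fun x => by simp
        right_inv := fun x => by simp }
    · rw [Subgroup.coe_mul, mul_assoc, ← hf]
      exact x.2
    · rw [hf, Subgroup.coe_mul, ← mul_assoc, ← mul_assoc, Subgroup.coe_inv, mul_inv_cancel, one_mul]
      exact x.2.2

end DoubleCosets

/-! ### The Siegel parabolic and its Levi decomposition -/

section Parabolic

open Matrix SymplecticGroup

variable {l F : Type*} [Fintype l] [DecidableEq l] [Field F]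

theorem fromBlocks_mem_symplecticGroup_iff {A C E : Matrix l l F} :
    fromBlocks A C 0 E ∈ symplecticGroup l F ↔ A * Eᵀ = 1 ∧ C * Aᵀ = A * Cᵀ := by
  rw [SymplecticGroup.mem_iff, Matrix.J, fromBlocks_transpose, fromBlocks_multiply,
    fromBlocks_multiply, fromBlocks_inj]
  simp only [Matrix.mul_zero, Matrix.mul_one, Matrix.mul_neg, zero_add, add_zero, Matrix.neg_mul,
    Matrix.zero_mul, transpose_zero, neg_zero, neg_inj]
  constructor
  · rintro ⟨h1, h2, -, -⟩
    exact ⟨h2, add_neg_eq_zero.1 h1⟩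
  · rintro ⟨h1, h2⟩
    refine ⟨add_neg_eq_zero.2 h2, h1, ?_, trivial⟩
    rw [← transpose_inj, transpose_mul, transpose_transpose, h1, transpose_one]

variable (l F) in
/-- The Siegel parabolic subgroup of the symplectic group. -/
def parabolicSubgroup : Subgroup (symplecticGroup l F) where
  carrier := {w | (w : Matrix (l ⊕ l) (l ⊕ l) F).toBlocks₂₁ = 0}
  one_mem' := by
    change (1 : Matrix (l ⊕ l) (l ⊕ l) F).toBlocks₂₁ = 0
    rw [← fromBlocks_one, toBlocks_fromBlocks₂₁]
  mul_mem' := by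
    intro a b ha hb
    change ((a : Matrix (l ⊕ l) (l ⊕ l) F) * b).toBlocks₂₁ = 0
    simp only [Set.mem_ofPred_eq] at ha hb
    rw [← fromBlocks_toBlocks (a : Matrix (l ⊕ l) (l ⊕ l) F),
      ← fromBlocks_toBlocks (b : Matrix (l ⊕ l) (l ⊕ l) F), fromBlocks_multiply,
      toBlocks_fromBlocks₂₁, ha, hb]
    simp
  inv_mem' := by
    intro a ha
    simp only [Set.mem_ofPred_eq] at ha ⊢
    rw [coe_inv, ← fromBlocks_toBlocks (a : Matrix (l ⊕ l) (l ⊕ l) F), Matrix.J, fromBlocks_neg,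
      fromBlocks_transpose, fromBlocks_multiply, fromBlocks_multiply, toBlocks_fromBlocks₂₁, ha]
    simp

theorem mem_parabolicSubgroup_iff (w : symplecticGroup l F) :
    w ∈ parabolicSubgroup l F ↔ (w : Matrix (l ⊕ l) (l ⊕ l) F).toBlocks₂₁ = 0 := Iff.rfl

variable (l F) in
/-- The pairs `(A, B)` with `A` invertible and `B` symmetric. -/
def IsLeviPair (x : Matrix l l F × Matrix l l F) : Prop := IsUnit x.1.det ∧ x.2ᵀ = x.2

theorem leviPair_mem_symplecticGroup {x : Matrix l l F × Matrix l l F} (hx : IsLeviPair l F x) :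
    fromBlocks x.1 (x.1 * x.2) 0 x.1⁻¹ᵀ ∈ symplecticGroup l F := by
  rw [fromBlocks_mem_symplecticGroup_iff, transpose_transpose, mul_nonsing_inv _ hx.1,
    transpose_mul, hx.2, Matrix.mul_assoc]
  exact ⟨rfl, rfl⟩

theorem isLeviPair_of_mem {A C E : Matrix l l F} (h : fromBlocks A C 0 E ∈ symplecticGroup l F) :
    IsLeviPair l F (A, A⁻¹ * C) ∧ A * (A⁻¹ * C) = C ∧ A⁻¹ᵀ = E := by
  obtain ⟨h1, h2⟩ := fromBlocks_mem_symplecticGroup_iff.1 h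
  have hA : IsUnit A.det := isUnit_det_of_right_inverse h1
  have hinv : A⁻¹ = Eᵀ := inv_eq_right_inv h1
  refine ⟨⟨hA, ?_⟩, mul_nonsing_inv_cancel_left _ _ hA, by rw [hinv, transpose_transpose]⟩
  have h3 : Eᵀ * A = 1 := mul_eq_one_comm.1 h1
  have h4 : Aᵀ * E = 1 := by rw [← transpose_inj, transpose_mul, transpose_transpose, h3, transpose_one]
  change (A⁻¹ * C)ᵀ = A⁻¹ * C
  rw [hinv, transpose_mul, transpose_transpose]
  calc Cᵀ * E = (Eᵀ * A) * (Cᵀ * E) := by rw [h3, one_mul]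
    _ = Eᵀ * (C * Aᵀ) * E := by rw [h2]; simp only [Matrix.mul_assoc]
    _ = Eᵀ * C * (Aᵀ * E) := by simp only [Matrix.mul_assoc]
    _ = Eᵀ * C := by rw [h4, mul_one]

variable (l F) in
/-- Levi decomposition of the Siegel parabolic subgroup. -/
noncomputable def leviEquiv : {x // IsLeviPair l F x} ≃ parabolicSubgroup l F where
  toFun x := ⟨⟨_, leviPair_mem_symplecticGroup x.2⟩, toBlocks_fromBlocks₂₁ _ _ _ _⟩
  invFun w := ⟨(w.1.1.toBlocks₁₁, w.1.1.toBlocks₁₁⁻¹ * w.1.1.toBlocks₁₂), by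
    refine (isLeviPair_of_mem (E := w.1.1.toBlocks₂₂) ?_).1
    rw [← (mem_parabolicSubgroup_iff _).1 w.2, fromBlocks_toBlocks]
    exact w.1.2⟩
  left_inv x := by
    ext1
    simp only [toBlocks_fromBlocks₁₁, toBlocks_fromBlocks₁₂]
    rw [nonsing_inv_mul_cancel_left _ _ x.2.1]
  right_inv w := by
    have h : fromBlocks w.1.1.toBlocks₁₁ w.1.1.toBlocks₁₂ 0 w.1.1.toBlocks₂₂ ∈
        symplecticGroup l F := by
      rw [← (mem_parabolicSubgroup_iff _).1 w.2, fromBlocks_toBlocks]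
      exact w.1.2
    obtain ⟨-, h2, h3⟩ := isLeviPair_of_mem h
    ext1
    ext1
    simp only
    rw [h2, h3, ← (mem_parabolicSubgroup_iff _).1 w.2, fromBlocks_toBlocks]

theorem leviEquiv_coe (x : {x // IsLeviPair l F x}) :
    ((leviEquiv l F x : symplecticGroup l F) : Matrix (l ⊕ l) (l ⊕ l) F) =
      fromBlocks x.1.1 (x.1.1 * x.1.2) 0 x.1.1⁻¹ᵀ := rfl

theorem parabolic_eq_image (n : ℕ) (F : Type*) [Field F] :
    parabolic n F = (fun w : symplecticGroup (Fin n) F => (w : Matrix _ _ F)) ''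
      (parabolicSubgroup (Fin n) F : Set (symplecticGroup (Fin n) F)) := by
  have key (A B : Matrix (Fin n) (Fin n) F) : fromBlocks A 0 0 A⁻¹ᵀ * fromBlocks 1 B 0 1 =
      fromBlocks A (A * B) 0 A⁻¹ᵀ := by
    rw [fromBlocks_multiply]
    simp
  ext w
  constructor
  · rintro ⟨A, B, hA, hB, rfl⟩
    exact ⟨_, (leviEquiv (Fin n) F ⟨(A, B), hA, hB⟩).2, (key A B).symm⟩
  · rintro ⟨w, hw, rfl⟩
    refine ⟨_, _, ((leviEquiv (Fin n) F).symm ⟨w, hw⟩).2.1, ((leviEquiv (Fin n) F).symm ⟨w, hw⟩).2.2, ?_⟩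
    rw [key, ← leviEquiv_coe, Equiv.apply_symm_apply]

end Parabolic

/-! ### Reduction to counts of pairs (A, B) -/

section Reduction

/-- Transfers the group-theoretic count to double cosets formed in the monoid of all matrices. -/
theorem card_doubleCoset_map {G M : Type*} [Group G] [Monoid M] (φ : G →* M)
    (hφ : Function.Injective φ) (P : Subgroup G) (s : G) {X : Type*} (f : M → X) (β : X) :
    Nat.card {w // w ∈ DoubleCoset.doubleCoset s (P : Set G) P ∧ f (φ w) = β} =
      Nat.card {w : DoubleCoset.doubleCoset (φ s) (φ '' P) (φ '' P) // f w = β} := by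
  have hmem (w : {w // w ∈ DoubleCoset.doubleCoset s (P : Set G) P ∧ f (φ w) = β}) :
      φ w.1 ∈ DoubleCoset.doubleCoset (φ s) (φ '' P) (φ '' P) := by
    obtain ⟨a, ha, b, hb, hw⟩ := DoubleCoset.mem_doubleCoset.1 w.2.1
    exact DoubleCoset.mem_doubleCoset.2 ⟨φ a, ⟨a, ha, rfl⟩, φ b, ⟨b, hb, rfl⟩,
      by rw [hw, map_mul, map_mul]⟩
  refine Nat.card_congr (Equiv.ofBijective (fun w => ⟨⟨φ w.1, hmem w⟩, w.2.2⟩) ⟨?_, ?_⟩)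
  · intro w w' hww
    exact Subtype.ext (hφ (congrArg (fun x => (x.1.1 : M)) hww))
  · rintro ⟨⟨w, hw⟩, ht⟩
    obtain ⟨_, ⟨a, ha, rfl⟩, _, ⟨b, hb, rfl⟩, hw'⟩ := DoubleCoset.mem_doubleCoset.1 hw
    rw [← map_mul, ← map_mul] at hw'
    subst hw'
    exact ⟨⟨a * s * b, DoubleCoset.mem_doubleCoset.2 ⟨a, ha, b, hb, rfl⟩, ht⟩, rfl⟩

open Matrix

theorem trace_fromBlocks {m k R : Type*} [Fintype m] [Fintype k] [AddCommMonoid R]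
    (A : Matrix m m R) (B : Matrix m k R) (C : Matrix k m R) (D : Matrix k k R) :
    (fromBlocks A B C D).trace = A.trace + D.trace := by
  simp [trace, Fintype.sum_sum_type]

variable {l F : Type*} [Fintype l] [DecidableEq l] [Field F]

/-- The number of Levi pairs that conjugation by the element `σ` attached to the idempotent `D`
keeps in the parabolic subgroup. -/
noncomputable def stabilizerCount (D : Matrix l l F) : ℕ :=
  Nat.card {x : Matrix l l F × Matrix l l F // IsLeviPair l F x ∧ D * x.1 * (1 - D) = 0 ∧
    D * (x.1 * x.2) * D = 0 ∧ (1 - D) * x.1⁻¹ᵀ * D = 0}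

/-- The number of Levi pairs whose product with `σ` has trace `β`. -/
noncomputable def pairTraceCount (D : Matrix l l F) (β : F) : ℕ :=
  Nat.card {x : Matrix l l F × Matrix l l F // IsLeviPair l F x ∧
    (x.1 * (1 - D)).trace + (x.1 * x.2 * D).trace + (x.1⁻¹ᵀ * (1 - D)).trace = β}

/-- The lower left block is a sum of three terms lying in different Peirce corners of the idempotent
D, so it vanishes only if each term does. -/
theorem toBlocks₂₁_conj_eq_zero_iff {D A C E : Matrix l l F} (hD : D * D = D) :
    (fromBlocks (1 - D) D D (1 - D) * fromBlocks A C 0 E *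
      fromBlocks (1 - D) D D (1 - D)).toBlocks₂₁ = 0 ↔
      D * A * (1 - D) = 0 ∧ D * C * D = 0 ∧ (1 - D) * E * D = 0 := by
  have h1 : D * (1 - D) = 0 := by rw [mul_sub, mul_one, hD, sub_self]
  have h2 : (1 - D) * D = 0 := by rw [sub_mul, one_mul, hD, sub_self]
  have h3 : (1 - D) * (1 - D) = 1 - D := by rw [mul_sub, mul_one, h2, sub_zero]
  have key : (fromBlocks (1 - D) D D (1 - D) * fromBlocks A C 0 E *
      fromBlocks (1 - D) D D (1 - D)).toBlocks₂₁ =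
      D * A * (1 - D) + D * C * D + (1 - D) * E * D := by
    rw [fromBlocks_multiply, fromBlocks_multiply, toBlocks_fromBlocks₂₁]
    noncomm_ring
  rw [key]
  constructor
  · intro h
    have e1 : D * (D * A * (1 - D) + D * C * D + (1 - D) * E * D) * (1 - D) = D * A * (1 - D) := by
      calc _ = (D * D) * A * ((1 - D) * (1 - D)) + (D * D) * C * (D * (1 - D))
          + (D * (1 - D)) * E * (D * (1 - D)) := by noncomm_ring
        _ = _ := by rw [hD, h1, h3]; noncomm_ring
    have e2 : D * (D * A * (1 - D) + D * C * D + (1 - D) * E * D) * D = D * C * D := by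
      calc _ = (D * D) * A * ((1 - D) * D) + (D * D) * C * (D * D)
          + (D * (1 - D)) * E * (D * D) := by noncomm_ring
        _ = _ := by rw [hD, h1, h2]; noncomm_ring
    rw [h, mul_zero, zero_mul] at e1 e2
    refine ⟨e1.symm, e2.symm, ?_⟩
    rwa [← e1, ← e2, zero_add, zero_add] at h
  · rintro ⟨e1, e2, e3⟩
    rw [e1, e2, e3, add_zero, add_zero]

/-- Characteristic two is essential here: σ carries no signs. -/
theorem idempotent_mem_symplecticGroup [CharP F 2] {D : Matrix l l F} (hD : D * D = D)
    (hDt : Dᵀ = D) : fromBlocks (1 - D) D D (1 - D) ∈ symplecticGroup l F := by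
  have h1 : D * (1 - D) = 0 := by rw [mul_sub, mul_one, hD, sub_self]
  have h2 : (1 - D) * D = 0 := by rw [sub_mul, one_mul, hD, sub_self]
  have h3 : (1 - D) * (1 - D) = 1 - D := by rw [mul_sub, mul_one, h2, sub_zero]
  have hneg (M : Matrix l l F) : -M = M := by ext i j; simp [CharTwo.neg_eq]
  rw [SymplecticGroup.mem_iff, Matrix.J, fromBlocks_transpose, fromBlocks_multiply,
    fromBlocks_multiply]
  simp [hDt, transpose_sub, h1, h2, h3, hD, hneg]

theorem idempotent_mul_self {D : Matrix l l F} (hD : D * D = D) :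
    fromBlocks (1 - D) D D (1 - D) * fromBlocks (1 - D) D D (1 - D) = 1 := by
  have h1 : D * (1 - D) = 0 := by rw [mul_sub, mul_one, hD, sub_self]
  have h2 : (1 - D) * D = 0 := by rw [sub_mul, one_mul, hD, sub_self]
  have h3 : (1 - D) * (1 - D) = 1 - D := by rw [mul_sub, mul_one, h2, sub_zero]
  rw [fromBlocks_multiply, ← fromBlocks_one, h1, h2, h3, hD]
  simp

theorem card_image_doubleCoset_mul [CharP F 2] {D : Matrix l l F} (hD : D * D = D)
    (hDt : Dᵀ = D) {P : Set (Matrix (l ⊕ l) (l ⊕ l) F)}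
    (hP : P = (fun w : symplecticGroup l F => (w : Matrix _ _ F)) ''
      (parabolicSubgroup l F : Set (symplecticGroup l F))) (β : F) :
    Nat.card {w : DoubleCoset.doubleCoset (fromBlocks (1 - D) D D (1 - D)) P P //
        (w : Matrix (l ⊕ l) (l ⊕ l) F).trace = β} * stabilizerCount D =
      Nat.card {x // IsLeviPair l F x} * pairTraceCount D β := by
  let s : symplecticGroup l F := ⟨_, idempotent_mem_symplecticGroup hD hDt⟩
  have hs : s⁻¹ = s := inv_eq_of_mul_eq_one_left (Subtype.ext (idempotent_mul_self hD))
  have h := card_doubleCoset_mul_card (parabolicSubgroup l F) s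
    (fun w => (w : Matrix (l ⊕ l) (l ⊕ l) F).trace) (fun a b => trace_mul_comm _ _) β
  have e1 := card_doubleCoset_map (symplecticGroup l F).subtype Subtype.val_injective
    (parabolicSubgroup l F) s (fun w => w.trace) β
  have e2 : Nat.card {p : parabolicSubgroup l F // s⁻¹ * p * s ∈ parabolicSubgroup l F} =
      stabilizerCount D := by
    let r : Matrix l l F × Matrix l l F → Prop := fun x => D * x.1 * (1 - D) = 0 ∧
      D * (x.1 * x.2) * D = 0 ∧ (1 - D) * x.1⁻¹ᵀ * D = 0
    have hr (x : {x // IsLeviPair l F x}) :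
        r x.1 ↔ s⁻¹ * (leviEquiv l F x) * s ∈ parabolicSubgroup l F := by
      rw [hs, mem_parabolicSubgroup_iff]
      exact (toBlocks₂₁_conj_eq_zero_iff hD).symm
    exact (Nat.card_congr ((leviEquiv l F).subtypeEquiv hr)).symm.trans
      (Nat.card_congr (Equiv.subtypeSubtypeEquivSubtypeInter (IsLeviPair l F) r))
  have e3 : Nat.card {p : parabolicSubgroup l F //
      ((p * s : symplecticGroup l F) : Matrix (l ⊕ l) (l ⊕ l) F).trace = β} =
      pairTraceCount D β := by
    let r : Matrix l l F × Matrix l l F → Prop := fun x =>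
      (x.1 * (1 - D)).trace + (x.1 * x.2 * D).trace + (x.1⁻¹ᵀ * (1 - D)).trace = β
    have hr (x : {x // IsLeviPair l F x}) : r x.1 ↔
        ((leviEquiv l F x * s : symplecticGroup l F) : Matrix (l ⊕ l) (l ⊕ l) F).trace = β := by
      have : ((leviEquiv l F x * s : symplecticGroup l F) : Matrix (l ⊕ l) (l ⊕ l) F) =
          fromBlocks x.1.1 (x.1.1 * x.1.2) 0 x.1.1⁻¹ᵀ * fromBlocks (1 - D) D D (1 - D) := rfl
      rw [this, fromBlocks_multiply, trace_fromBlocks, trace_add, Matrix.zero_mul, zero_add]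
    exact (Nat.card_congr ((leviEquiv l F).subtypeEquiv hr)).symm.trans
      (Nat.card_congr (Equiv.subtypeSubtypeEquivSubtypeInter (IsLeviPair l F) r))
  rw [e2, e3, ← Nat.card_congr (leviEquiv l F)] at h
  rw [hP, ← h]
  congr 1
  exact e1.symm

theorem sigma_eq (n r : ℕ) (F : Type*) [Field F] :
    sigma n r F = fromBlocks (1 - diagonal fun i : Fin n => if (i : ℕ) < r then 1 else 0)
      (diagonal fun i : Fin n => if (i : ℕ) < r then 1 else 0)
      (diagonal fun i : Fin n => if (i : ℕ) < r then 1 else 0)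
      (1 - diagonal fun i : Fin n => if (i : ℕ) < r then 1 else 0) := by
  rw [sigma, ← diagonal_one, diagonal_sub]
  congr 2 <;> ext i <;> split_ifs <;> simp

end Reduction

/-! ### Equidistribution of B ↦ Tr(DAB) -/

section Counting

open Matrix

theorem card_mul_card_fiber {F V : Type*} [Field F] [Finite F] [AddCommGroup V] [Module F V]
    [Finite V] {φ : V →ₗ[F] F} (hφ : φ ≠ 0) (c : F) :
    Nat.card F * Nat.card {v // φ v = c} = Nat.card V := by
  have := Fintype.ofFinite F
  have hsurj := LinearMap.surjective hφ
  have h (d : F) : Nat.card {v // φ v = d} = Nat.card {v // φ v = c} := by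
    obtain ⟨w, hw⟩ := hsurj (c - d)
    refine Nat.card_congr ((Equiv.addRight w).subtypeEquiv fun v => ?_)
    rw [Equiv.coe_addRight, map_add, hw, add_sub, sub_eq_iff_eq_add, add_comm c, add_left_inj]
  rw [← Nat.card_congr (Equiv.sigmaFiberEquiv φ), Nat.card_sigma, Finset.sum_congr rfl fun d _ => h d]
  simp [Nat.card_eq_fintype_card]

theorem card_subtype_and {α : Type*} [Finite α] (p r : α → Prop) [Fintype {a // p a}]
    [DecidablePred fun a : {a // p a} => r a] :
    Nat.card {a // p a ∧ r a} = ∑ a : {a // p a}, if r a then 1 else 0 := by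
  rw [← Nat.card_congr (Equiv.subtypeSubtypeEquivSubtypeInter p r), Nat.card_eq_fintype_card,
    Fintype.card_subtype, Finset.card_filter]

theorem card_symmetric {l F : Type*} [Fintype l] [DecidableEq l] [Fintype F] :
    Nat.card {B : Matrix l l F // Bᵀ = B} = Fintype.card F ^ (Fintype.card l + 1).choose 2 := by
  rw [← Sym2.card, ← Fintype.card_fun, ← Nat.card_eq_fintype_card]
  refine Nat.card_congr (Equiv.trans (Equiv.subtypeEquivRight fun B => ?_) Sym2.lift)
  constructor
  · intro h i j
    exact congrFun (congrFun h j) i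
  · intro h
    ext i j
    exact h j i

variable {l m F : Type*} [Field F] [Fintype l] [DecidableEq l] [Fintype m] [DecidableEq m]

variable (l F) in
/-- The space of symmetric matrices. -/
def symmetricSubmodule : Submodule F (Matrix l l F) where
  carrier := {B | Bᵀ = B}
  add_mem' := fun ha hb => by
    simp only [Set.mem_ofPred_eq] at *
    rw [transpose_add, ha, hb]
  zero_mem' := transpose_zero
  smul_mem' := fun c B hB => by
    simp only [Set.mem_ofPred_eq] at *
    rw [transpose_smul, hB]

/-- The linear functional `B ↦ Tr (M B)` on symmetric matrices. -/
def traceMulFunctional (M : Matrix l l F) : symmetricSubmodule l F →ₗ[F] F :=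
  (traceLinearMap l F F ∘ₗ LinearMap.mulLeft F M) ∘ₗ (symmetricSubmodule l F).subtype

theorem traceMulFunctional_apply (M : Matrix l l F) (B : symmetricSubmodule l F) :
    traceMulFunctional M B = (M * (B : Matrix l l F)).trace := rfl

/-- The test matrices E_ij + E_ji and E_ii detect the alternating condition; conversely the terms
(i, j) and (j, i) cancel. In characteristic two the zero diagonal is a condition of its own. -/
theorem traceMulFunctional_eq_zero_iff (M : Matrix l l F) :
    traceMulFunctional M = 0 ↔ IsAlternating M := by
  constructor
  · intro h
    have h' (B : Matrix l l F) (hB : Bᵀ = B) : (M * B).trace = 0 := LinearMap.congr_fun h ⟨B, hB⟩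
    refine ⟨?_, fun i => ?_⟩
    · ext i j
      have := h' (single i j 1 + single j i 1) (by
        rw [transpose_add, transpose_single, transpose_single, add_comm])
      rw [mul_add, trace_add, trace_mul_single, trace_mul_single, MulOpposite.op_one, one_smul,
        one_smul] at this
      rw [transpose_apply, neg_apply]
      exact eq_neg_of_add_eq_zero_left this
    · have := h' (single i i 1) (transpose_single _ _ _)
      rwa [trace_mul_single, MulOpposite.op_one, one_smul] at this
  · rintro ⟨h1, h2⟩
    ext ⟨B, hB⟩
    rw [traceMulFunctional_apply, LinearMap.zero_apply]
    simp only [trace, diag_apply, mul_apply]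
    rw [← Fintype.sum_prod_type' (fun i j => M i j * B j i)]
    refine Finset.sum_involution (fun p _ => p.swap) ?_ ?_ ?_ ?_
    · intro p _
      have e1 := congrFun (congrFun h1 p.1) p.2
      have e2 : B p.2 p.1 = B p.1 p.2 := congrFun (congrFun hB p.1) p.2
      rw [transpose_apply, neg_apply] at e1
      simp only [Prod.fst_swap, Prod.snd_swap, e1, e2]
      ring
    · rintro ⟨i, j⟩ _ hne heq
      obtain rfl : j = i := (Prod.ext_iff.1 heq).1
      simp [h2] at hne
    · simp
    · simp

variable (l F) in
/-- The number of invertible matrices. -/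
noncomputable def invertibleCount : ℕ := Nat.card {A : Matrix l l F // IsUnit A.det}

/-- The number of invertible `A` with `D A` alternating. -/
noncomputable def alternatingRowsCount (D : Matrix l l F) : ℕ :=
  Nat.card {A : Matrix l l F // IsUnit A.det ∧ IsAlternating (D * A)}

/-- The number of invertible `A` with `D A` alternating and prescribed trace of
`(A + A⁻ᵀ) (1 - D)`. -/
noncomputable def alternatingRowsTraceCount (D : Matrix l l F) (β : F) : ℕ :=
  Nat.card {A : Matrix l l F // IsUnit A.det ∧ IsAlternating (D * A) ∧
    (A * (1 - D)).trace + (A⁻¹ᵀ * (1 - D)).trace = β}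

/-- Sum over A. If DA is not alternating, each value of Tr(DAB) is taken by a fraction 1/q of the
symmetric B. If it is, the value is 0 for every B, and only the trace term in A decides. The
correction stands on the left to avoid subtraction of natural numbers. -/
theorem card_mul_pairTraceCount [Fintype F] (D : Matrix l l F) (β : F) :
    Fintype.card F * pairTraceCount D β +
        Nat.card (symmetricSubmodule l F) * alternatingRowsCount D =
      Nat.card (symmetricSubmodule l F) * (invertibleCount l F +
        Fintype.card F * alternatingRowsTraceCount D β) := by
  classical
  let t : Matrix l l F → F := fun A => (A * (1 - D)).trace + (A⁻¹ᵀ * (1 - D)).trace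
  have h1 : pairTraceCount D β = ∑ A : {A : Matrix l l F // IsUnit A.det},
      Nat.card {B : symmetricSubmodule l F // traceMulFunctional (D * A.1) B = β - t A} := by
    rw [← Nat.card_sigma, pairTraceCount]
    have key (A B : Matrix l l F) : (A * (1 - D)).trace + (A * B * D).trace +
        (A⁻¹ᵀ * (1 - D)).trace = β ↔ (D * A * B).trace = β - t A := by
      rw [trace_mul_comm (A * B) D, ← Matrix.mul_assoc, eq_sub_iff_add_eq]
      simp only [t]
      rw [add_right_comm, add_comm]
    exact Nat.card_congr
      { toFun := fun x => ⟨⟨x.1.1, x.2.1.1⟩, ⟨x.1.2, x.2.1.2⟩, (key _ _).1 x.2.2⟩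
        invFun := fun x => ⟨(x.1.1, x.2.1.1), ⟨x.1.2, x.2.1.2⟩, (key _ _).2 x.2.2⟩
        left_inv := fun x => rfl
        right_inv := fun x => rfl }
  have h2 : alternatingRowsCount D = ∑ A : {A : Matrix l l F // IsUnit A.det},
      if IsAlternating (D * A.1) then 1 else 0 := card_subtype_and _ _
  have h3 : alternatingRowsTraceCount D β = ∑ A : {A : Matrix l l F // IsUnit A.det},
      if IsAlternating (D * A.1) ∧ t A = β then 1 else 0 := card_subtype_and _ _
  have h4 : invertibleCount l F = ∑ A : {A : Matrix l l F // IsUnit A.det}, 1 := by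
    rw [invertibleCount, Nat.card_eq_fintype_card]
    simp
  rw [h1, h2, h3, h4]
  simp only [Finset.mul_sum, mul_add, ← Finset.sum_add_distrib]
  refine Finset.sum_congr rfl fun A _ => ?_
  by_cases hA : IsAlternating (D * A.1)
  · have h0 := (traceMulFunctional_eq_zero_iff _).2 hA
    simp only [hA, h0, if_true, true_and, LinearMap.zero_apply]
    by_cases ht : t A = β
    · simp [ht, add_comm, mul_comm]
    · have : ¬ (0 = β - t A) := fun h => ht (sub_eq_zero.1 h.symm).symm
      simp [ht, this]
  · have h0 := mt (traceMulFunctional_eq_zero_iff _).1 hA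
    have := card_mul_card_fiber h0 (β - t A)
    rw [Nat.card_eq_fintype_card] at this
    rw [this]
    simp [hA]

section Transport

variable (e : l ≃ m) (D : Matrix l l F)

theorem alternatingRowsCount_reindex :
    alternatingRowsCount (reindexAlgEquiv F F e D) = alternatingRowsCount D := by
  refine (Nat.card_congr ((reindexAlgEquiv F F e).toEquiv.subtypeEquiv fun A => ?_)).symm
  simp only [AlgEquiv.toEquiv_eq_coe, EquivLike.coe_coe]
  rw [← map_mul]
  simp only [coe_reindexAlgEquiv, IsAlternating.reindex, det_reindex_self]

theorem trace_reindexAlgEquiv (A : Matrix l l F) :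
    (reindexAlgEquiv F F e A).trace = A.trace := by
  simp [trace, Equiv.sum_comp e.symm (fun i => A i i)]

theorem transpose_reindexAlgEquiv (A : Matrix l l F) :
    (reindexAlgEquiv F F e A)ᵀ = reindexAlgEquiv F F e Aᵀ := rfl

theorem inv_reindexAlgEquiv (A : Matrix l l F) :
    (reindexAlgEquiv F F e A)⁻¹ = reindexAlgEquiv F F e A⁻¹ := by
  simp only [coe_reindexAlgEquiv, inv_reindex]

theorem alternatingRowsTraceCount_reindex (β : F) :
    alternatingRowsTraceCount (reindexAlgEquiv F F e D) β = alternatingRowsTraceCount D β := by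
  refine (Nat.card_congr ((reindexAlgEquiv F F e).toEquiv.subtypeEquiv fun A => ?_)).symm
  simp only [AlgEquiv.toEquiv_eq_coe, EquivLike.coe_coe]
  rw [inv_reindexAlgEquiv, transpose_reindexAlgEquiv, ← map_one (reindexAlgEquiv F F e), ← map_sub,
    ← map_mul, ← map_mul, ← map_mul, trace_reindexAlgEquiv, trace_reindexAlgEquiv]
  simp only [coe_reindexAlgEquiv, IsAlternating.reindex, det_reindex_self]

theorem stabilizerCount_reindex :
    stabilizerCount (reindexAlgEquiv F F e D) = stabilizerCount D := by
  refine (Nat.card_congr (((reindexAlgEquiv F F e).toEquiv.prodCongr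
    (reindexAlgEquiv F F e).toEquiv).subtypeEquiv fun x => ?_)).symm
  simp only [AlgEquiv.toEquiv_eq_coe, Equiv.prodCongr_apply, EquivLike.coe_coe,
    Prod.map_fst, Prod.map_snd, IsLeviPair]
  rw [inv_reindexAlgEquiv, transpose_reindexAlgEquiv, transpose_reindexAlgEquiv,
    ← map_one (reindexAlgEquiv F F e), ← map_sub]
  simp only [← map_mul, EmbeddingLike.map_eq_zero_iff, EmbeddingLike.apply_eq_iff_eq]
  simp only [coe_reindexAlgEquiv, det_reindex_self]

end Transport

end Counting

/-! ### Block form of the counts for D = diag(1, 0) -/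

section Blocks

open Matrix

variable {m k F : Type*} [Field F] [Fintype m] [DecidableEq m] [Fintype k] [DecidableEq k]

variable (m k F) in
/-- The projection onto the first summand. -/
def blockProjection : Matrix (m ⊕ k) (m ⊕ k) F := fromBlocks 1 0 0 0

theorem one_sub_blockProjection {m k : Type*} [DecidableEq m] [DecidableEq k] : 1 - blockProjection m k F = fromBlocks 0 0 0 1 := by
  rw [blockProjection, ← fromBlocks_one, sub_eq_add_neg, fromBlocks_neg, fromBlocks_add]
  simp

/-- The lower block row of DA is zero, so skew-symmetry kills A₁₂ as well and A becomes block
triangular. -/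
theorem isAlternating_blockProjection_mul_iff (A₁₁ : Matrix m m F) (A₁₂ : Matrix m k F)
    (A₂₁ : Matrix k m F) (A₂₂ : Matrix k k F) :
    IsAlternating (blockProjection m k F * fromBlocks A₁₁ A₁₂ A₂₁ A₂₂) ↔
      IsAlternating A₁₁ ∧ A₁₂ = 0 := by
  have h : blockProjection m k F * fromBlocks A₁₁ A₁₂ A₂₁ A₂₂ = fromBlocks A₁₁ A₁₂ 0 0 := by
    rw [blockProjection, fromBlocks_multiply]
    simp
  rw [h]
  constructor
  · rintro ⟨h1, h2⟩
    rw [fromBlocks_transpose, fromBlocks_neg, fromBlocks_inj] at h1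
    exact ⟨⟨h1.1, fun i => h2 (Sum.inl i)⟩, by simpa using h1.2.1.symm⟩
  · rintro ⟨⟨h1, h2⟩, rfl⟩
    refine ⟨?_, ?_⟩
    · rw [fromBlocks_transpose, fromBlocks_neg, h1]
      simp
    · rintro (i | i)
      · exact h2 i
      · rfl

theorem isUnit_det_fromBlocks_zero₁₂_iff {A₁₁ : Matrix m m F} {A₂₁ : Matrix k m F}
    {A₂₂ : Matrix k k F} :
    IsUnit (fromBlocks A₁₁ 0 A₂₁ A₂₂).det ↔ IsUnit A₁₁.det ∧ IsUnit A₂₂.det := by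
  rw [det_fromBlocks_zero₁₂, IsUnit.mul_iff]

theorem inv_fromBlocks_zero₁₂ {A₁₁ : Matrix m m F} {A₂₁ : Matrix k m F} {A₂₂ : Matrix k k F}
    (h₁ : IsUnit A₁₁.det) (h₂ : IsUnit A₂₂.det) :
    (fromBlocks A₁₁ 0 A₂₁ A₂₂)⁻¹ = fromBlocks A₁₁⁻¹ 0 (-(A₂₂⁻¹ * A₂₁ * A₁₁⁻¹)) A₂₂⁻¹ :=
  inv_fromBlocks_zero₁₂_of_isUnit_iff _ _ _
    (by simp only [isUnit_iff_isUnit_det, h₁, h₂])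

theorem card_matrix {m k F : Type*} [Fintype m] [Fintype k] [Fintype F] :
    Nat.card (Matrix m k F) = Fintype.card F ^ (Fintype.card m * Fintype.card k) := by
  classical
  rw [Nat.card_eq_fintype_card, Fintype.card_congr Matrix.of.symm, Fintype.card_fun,
    Fintype.card_fun, ← pow_mul, mul_comm]

theorem card_blockTriangular {m k : Type*} [Fintype m] [Fintype k] [Fintype F] (p : Matrix m m F → Prop) (r : Matrix k k F → Prop) :
    Nat.card {A : Matrix (m ⊕ k) (m ⊕ k) F // p A.toBlocks₁₁ ∧ A.toBlocks₁₂ = 0 ∧ r A.toBlocks₂₂} =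
      Nat.card {A // p A} * Fintype.card F ^ (Fintype.card m * Fintype.card k) *
        Nat.card {A // r A} := by
  have h : Nat.card (Matrix k m F) = Fintype.card F ^ (Fintype.card m * Fintype.card k) := by
    rw [card_matrix, mul_comm]
  rw [← h, ← Nat.card_prod, ← Nat.card_prod]
  exact Nat.card_congr
    { toFun := fun A => ((⟨A.1.toBlocks₁₁, A.2.1⟩, A.1.toBlocks₂₁), ⟨A.1.toBlocks₂₂, A.2.2.2⟩)
      invFun := fun x => ⟨fromBlocks x.1.1.1 0 x.1.2 x.2.1, x.1.1.2, rfl, x.2.2⟩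
      left_inv := fun A => Subtype.ext (by
        have := fromBlocks_toBlocks A.1
        rw [A.2.2.1] at this
        exact this)
      right_inv := fun x => rfl }

theorem alternatingRowsCount_blockProjection [Fintype F] :
    alternatingRowsCount (blockProjection m k F) =
      alternatingCount m F * Fintype.card F ^ (Fintype.card m * Fintype.card k) *
        invertibleCount k F := by
  rw [alternatingCount, invertibleCount, ← card_blockTriangular]
  refine Nat.card_congr (Equiv.subtypeEquivRight fun A => ?_)
  rw [← fromBlocks_toBlocks A, isAlternating_blockProjection_mul_iff, toBlocks_fromBlocks₁₁,
    toBlocks_fromBlocks₁₂, toBlocks_fromBlocks₂₂]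
  constructor
  · rintro ⟨h1, h2, h3⟩
    rw [h3, isUnit_det_fromBlocks_zero₁₂_iff] at h1
    exact ⟨⟨h2, h1.1⟩, h3, h1.2⟩
  · rintro ⟨⟨h1, h2⟩, h3, h4⟩
    rw [h3, isUnit_det_fromBlocks_zero₁₂_iff]
    exact ⟨⟨h2, h4⟩, h1, rfl⟩

theorem trace_mul_one_sub_blockProjection (A₁₁ : Matrix m m F) (A₁₂ : Matrix m k F)
    (A₂₁ : Matrix k m F) (A₂₂ : Matrix k k F) :
    (fromBlocks A₁₁ A₁₂ A₂₁ A₂₂ * (1 - blockProjection m k F)).trace = A₂₂.trace := by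
  rw [one_sub_blockProjection, fromBlocks_multiply, trace_fromBlocks]
  simp

theorem alternatingRowsTraceCount_blockProjection [Fintype F] (β : F) :
    alternatingRowsTraceCount (blockProjection m k F) β =
      alternatingCount m F * Fintype.card F ^ (Fintype.card m * Fintype.card k) *
        traceInvCount k β := by
  rw [alternatingCount, traceInvCount, ← card_blockTriangular]
  refine Nat.card_congr (Equiv.subtypeEquivRight fun A => ?_)
  rw [← fromBlocks_toBlocks A, isAlternating_blockProjection_mul_iff, toBlocks_fromBlocks₁₁,
    toBlocks_fromBlocks₁₂, toBlocks_fromBlocks₂₂]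
  have htr (h1 : IsUnit A.toBlocks₁₁.det) (h2 : IsUnit A.toBlocks₂₂.det) :
      (fromBlocks A.toBlocks₁₁ 0 A.toBlocks₂₁ A.toBlocks₂₂ * (1 - blockProjection m k F)).trace +
        ((fromBlocks A.toBlocks₁₁ 0 A.toBlocks₂₁ A.toBlocks₂₂)⁻¹ᵀ *
          (1 - blockProjection m k F)).trace =
        A.toBlocks₂₂.trace + A.toBlocks₂₂⁻¹.trace := by
    rw [inv_fromBlocks_zero₁₂ h1 h2, fromBlocks_transpose, trace_mul_one_sub_blockProjection,
      trace_mul_one_sub_blockProjection, trace_transpose]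
  constructor
  · rintro ⟨h1, ⟨h2, h3⟩, h4⟩
    rw [h3] at h1 h4
    rw [isUnit_det_fromBlocks_zero₁₂_iff] at h1
    rw [htr h1.1 h1.2] at h4
    exact ⟨⟨h2, h1.1⟩, h3, h1.2, h4⟩
  · rintro ⟨⟨h1, h2⟩, h3, h4, h5⟩
    rw [h3, isUnit_det_fromBlocks_zero₁₂_iff, htr h2 h4]
    exact ⟨⟨h2, h4⟩, ⟨h1, rfl⟩, h5⟩

theorem card_symmetric_zero_block {m : Type*} [Fintype m] [Fintype F] :
    Nat.card {B : Matrix (m ⊕ k) (m ⊕ k) F // Bᵀ = B ∧ B.toBlocks₁₁ = 0} =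
      Fintype.card F ^ (Fintype.card m * Fintype.card k) *
        Fintype.card F ^ (Fintype.card k + 1).choose 2 := by
  have h : Nat.card (Matrix m k F) = Fintype.card F ^ (Fintype.card m * Fintype.card k) := by
    exact card_matrix
  rw [← h, ← card_symmetric, ← Nat.card_prod]
  refine Nat.card_congr
    { toFun := fun B => (B.1.toBlocks₁₂, ⟨B.1.toBlocks₂₂, ?_⟩)
      invFun := fun x => ⟨fromBlocks 0 x.1 x.1ᵀ x.2.1, ?_, rfl⟩
      left_inv := fun B => Subtype.ext ?_
      right_inv := fun x => rfl }
  · have := B.2.1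
    rw [← fromBlocks_toBlocks B.1, fromBlocks_transpose, fromBlocks_inj] at this
    exact this.2.2.2
  · rw [fromBlocks_transpose, x.2.2, transpose_zero, transpose_transpose]
  · have h1 := B.2.1
    have h2 := fromBlocks_toBlocks B.1
    rw [← h2, fromBlocks_transpose, fromBlocks_inj] at h1
    rw [B.2.2] at h2
    change fromBlocks 0 B.1.toBlocks₁₂ B.1.toBlocks₁₂ᵀ B.1.toBlocks₂₂ = B.1
    rw [h1.2.2.1]
    exact h2

/-- The condition A₁₂ = 0 already implies the one on A⁻ᵀ, and it reduces the middle one to A₁₁B₁₁ =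
0, that is, B₁₁ = 0. -/
theorem stabilizerCount_blockProjection [Fintype F] :
    stabilizerCount (blockProjection m k F) =
      (invertibleCount m F * Fintype.card F ^ (Fintype.card m * Fintype.card k) *
        invertibleCount k F) * (Fintype.card F ^ (Fintype.card m * Fintype.card k) *
        Fintype.card F ^ (Fintype.card k + 1).choose 2) := by
  rw [invertibleCount, invertibleCount, ← card_blockTriangular, ← card_symmetric_zero_block,
    ← Nat.card_prod]
  refine Nat.card_congr (Equiv.trans (Equiv.subtypeEquivRight fun x => ?_)
    Equiv.subtypeProdEquivProd)
  rw [one_sub_blockProjection, blockProjection]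
  obtain ⟨A, B⟩ := x
  obtain ⟨A₁₁, A₁₂, A₂₁, A₂₂, rfl⟩ : ∃ A₁₁ A₁₂ A₂₁ A₂₂, A = fromBlocks A₁₁ A₁₂ A₂₁ A₂₂ :=
    ⟨_, _, _, _, (fromBlocks_toBlocks A).symm⟩
  obtain ⟨B₁₁, B₁₂, B₂₁, B₂₂, rfl⟩ : ∃ B₁₁ B₁₂ B₂₁ B₂₂, B = fromBlocks B₁₁ B₁₂ B₂₁ B₂₂ :=
    ⟨_, _, _, _, (fromBlocks_toBlocks B).symm⟩
  have h0 : (fromBlocks 0 0 0 0 : Matrix (m ⊕ k) (m ⊕ k) F) = 0 := fromBlocks_zero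
  simp only [IsLeviPair, toBlocks_fromBlocks₁₁, toBlocks_fromBlocks₁₂, toBlocks_fromBlocks₂₂,
    fromBlocks_multiply, Matrix.one_mul, Matrix.zero_mul, Matrix.mul_one, Matrix.mul_zero,
    add_zero, zero_add, ← h0, fromBlocks_inj, and_true, true_and]
  constructor
  · rintro ⟨⟨hA, hB⟩, rfl, h, -⟩
    rw [isUnit_det_fromBlocks_zero₁₂_iff] at hA
    refine ⟨⟨hA.1, rfl, hA.2⟩, hB, ?_⟩
    rw [Matrix.zero_mul, add_zero] at h
    rw [← nonsing_inv_mul_cancel_left A₁₁ B₁₁ hA.1, h, Matrix.mul_zero]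
  · rintro ⟨⟨h1, rfl, h2⟩, hB, rfl⟩
    refine ⟨⟨isUnit_det_fromBlocks_zero₁₂_iff.2 ⟨h1, h2⟩, hB⟩, rfl, by simp, ?_⟩
    rw [inv_fromBlocks_zero₁₂ h1 h2, fromBlocks_transpose]
    simp [fromBlocks_multiply]

end Blocks

/-! ### Explicit fibre sizes -/

section Counts

open Matrix Finset

variable {F : Type*} [Field F] [Fintype F]

theorem invertibleCount_fin (n : ℕ) :
    (invertibleCount (Fin n) F : ℚ) = (Fintype.card F : ℚ) ^ n.choose 2 *
      ∏ i ∈ range n, ((Fintype.card F : ℚ) ^ (i + 1) - 1) := by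
  classical
  have h : invertibleCount (Fin n) F = Nat.card (GL (Fin n) F) := by
    refine Nat.card_congr
      { toFun := fun A => GeneralLinearGroup.mk'' A.1 A.2
        invFun := fun A => ⟨A.1, A.isUnit.map detMonoidHom⟩
        left_inv := fun A => rfl
        right_inv := fun A => Units.ext rfl }
  rw [h, card_GL_field, Fin.prod_univ_eq_prod_range
    (fun i => Fintype.card F ^ n - Fintype.card F ^ i), Nat.choose_two_right, ← sum_range_id,
    ← prod_pow_eq_pow_sum, ← prod_range_reflect (fun i => (Fintype.card F : ℚ) ^ (i + 1) - 1),
    ← prod_mul_distrib, Nat.cast_prod]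
  refine prod_congr rfl fun i hi => ?_
  have hi := mem_range.1 hi
  rw [Nat.cast_sub (Nat.pow_le_pow_right Fintype.card_pos hi.le), mul_sub, ← pow_add,
    show i + (n - 1 - i + 1) = n by omega]
  simp

theorem prod_range_two_mul (q : ℚ) (k : ℕ) : ∏ i ∈ range (2 * k), (q ^ (i + 1) - 1) =
    (∏ j ∈ Icc 1 k, (q ^ (2 * j) - 1)) * ∏ j ∈ Icc 1 k, (q ^ (2 * j - 1) - 1) := by
  induction k with
  | zero => simp
  | succ k ih =>
    rw [prod_Icc_succ_top (by omega), prod_Icc_succ_top (by omega), mul_add, mul_one,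
      prod_range_succ, prod_range_succ, ih, show 2 * k + 1 + 1 = 2 * k + 2 by omega,
      show 2 * k + 2 - 1 = 2 * k + 1 by omega]
    ring

theorem card_isLeviPair (n : ℕ) : Nat.card {x // IsLeviPair (Fin n) F x} =
    invertibleCount (Fin n) F * Fintype.card F ^ (n + 1).choose 2 := by
  have h := card_symmetric (l := Fin n) (F := F)
  rw [Fintype.card_fin] at h
  rw [← h, invertibleCount, ← Nat.card_prod]
  exact Nat.card_congr (Equiv.subtypeProdEquivProd (p := fun A : Matrix (Fin n) (Fin n) F =>
    IsUnit A.det) (q := fun B : Matrix (Fin n) (Fin n) F => Bᵀ = B))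

theorem reindex_diagonal {F : Type*} [Field F] (r t : ℕ) : reindexAlgEquiv F F finSumFinEquiv.symm
    (diagonal fun i : Fin (r + t) => if (i : ℕ) < r then 1 else 0) =
      blockProjection (Fin r) (Fin t) F := by
  ext (i | i) (j | j) <;> simp [blockProjection, diagonal_apply, one_apply, Fin.ext_iff]
  omega

/-- The double coset count and the equidistribution count combined, with denominators cleared. The
last factor on the right measures the deviation from equidistribution of Tr M + Tr M⁻¹ on GL_t. -/
theorem card_doubleCoset_sigma [CharP F 2] [DecidableEq F] (k t : ℕ) (β : F) :
    (Nat.card {w : DoubleCoset.doubleCoset (sigma (2 * k + t) (2 * k) F)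
        (parabolic (2 * k + t) F) (parabolic (2 * k + t) F) //
        (w : Matrix (Fin (2 * k + t) ⊕ Fin (2 * k + t)) _ F).trace = β} : ℚ) * Fintype.card F *
      (invertibleCount (Fin (2 * k)) F * invertibleCount (Fin t) F *
        (Fintype.card F : ℚ) ^ (4 * k * t + (t + 1).choose 2)) =
    invertibleCount (Fin (2 * k + t)) F *
      (Fintype.card F : ℚ) ^ (2 * (2 * k + t + 1).choose 2) *
      (invertibleCount (Fin (2 * k + t)) F +
        (Fintype.card F : ℚ) ^ (k * (k - 1) + 2 * k * t) *
          (∏ j ∈ Icc 1 k, ((Fintype.card F : ℚ) ^ (2 * j - 1) - 1)) *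
          (Fintype.card F * traceInvCount (Fin t) β - invertibleCount (Fin t) F)) := by
  set D : Matrix (Fin (2 * k + t)) (Fin (2 * k + t)) F :=
    diagonal fun i => if (i : ℕ) < 2 * k then 1 else 0 with hDdef
  have hD : D * D = D := by simp [hDdef, diagonal_mul_diagonal]
  have h1 := card_image_doubleCoset_mul hD (diagonal_transpose _) (parabolic_eq_image _ F) β
  have h2 := card_mul_pairTraceCount D β
  rw [show Nat.card (symmetricSubmodule (Fin (2 * k + t)) F) = _ from card_symmetric,
    Fintype.card_fin] at h2
  have e := reindex_diagonal (F := F) (2 * k) t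
  rw [← hDdef] at e
  rw [card_isLeviPair, ← stabilizerCount_reindex finSumFinEquiv.symm D, e,
    stabilizerCount_blockProjection, Fintype.card_fin, Fintype.card_fin] at h1
  rw [← alternatingRowsCount_reindex finSumFinEquiv.symm D,
    ← alternatingRowsTraceCount_reindex finSumFinEquiv.symm D, e,
    alternatingRowsCount_blockProjection, alternatingRowsTraceCount_blockProjection,
    Fintype.card_fin, Fintype.card_fin] at h2
  have h3 := alternatingCount_eq (l := Fin (2 * k)) (F := F) (Fintype.card_fin _)
  rw [← hDdef] at *
  rw [sigma_eq]
  have h1' := congrArg (Nat.cast (R := ℚ)) h1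
  have h2' := congrArg (Nat.cast (R := ℚ)) h2
  push_cast at h1' h2'
  rw [h3] at h2'
  generalize (pairTraceCount D β : ℚ) = p at *
  generalize (invertibleCount (Fin (2 * k + t)) F : ℚ) = gn at *
  generalize (invertibleCount (Fin (2 * k)) F : ℚ) = gr at *
  generalize (invertibleCount (Fin t) F : ℚ) = gt at *
  generalize (traceInvCount (Fin t) β : ℚ) = m at *
  generalize (∏ j ∈ Icc 1 k, ((Fintype.card F : ℚ) ^ (2 * j - 1) - 1)) = o at *
  generalize k * (k - 1) = K at *
  generalize (t + 1).choose 2 = T at *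
  generalize (2 * k + t + 1).choose 2 = S at *
  generalize (Fintype.card F : ℚ) = q at *
  linear_combination q * h1' + gn * q ^ S * h2'

theorem one_lt_card_cast : (1 : ℚ) < Fintype.card F := by
  exact_mod_cast Fintype.one_lt_card

theorem prod_Icc_pow_sub_one_pos {q : ℚ} (hq : 1 < q) (k : ℕ) (f : ℕ → ℕ)
    (hf : ∀ j, 1 ≤ j → f j ≠ 0) : 0 < ∏ j ∈ Icc 1 k, (q ^ f j - 1) :=
  prod_pos fun j hj => sub_pos.2 (one_lt_pow₀ hq (hf j (mem_Icc.1 hj).1))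

theorem choose_two_of_two_mul_eq {n N : ℕ} (h : 2 * N = n * (n - 1)) : n.choose 2 = N := by
  rw [Nat.choose_two_right]
  omega

theorem choose_two_two_mul (k : ℕ) : (2 * k).choose 2 = 2 * (k * (k - 1)) + k := by
  refine choose_two_of_two_mul_eq ?_
  rcases k with - | k
  · simp
  · rw [show 2 * (k + 1) - 1 = 2 * k + 1 by omega, Nat.add_sub_cancel]
    ring

theorem card_DCminus_trace [CharP F 2] [DecidableEq F] (k : ℕ) (β : F) :
    (Nat.card {w : DCminus (2 * k + 1) F // (w : Matrix (Fin (2 * k + 1) ⊕ Fin (2 * k + 1)) _ F).trace = β} : ℚ) =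
      (Fintype.card F : ℚ)⁻¹ * Aminus (2 * k + 1) (Fintype.card F) *
        (Bminus (2 * k + 1) (Fintype.card F) +
          (Fintype.card F * traceInvCount (Fin 1) β - (Fintype.card F - 1))) := by
  have h := card_doubleCoset_sigma k 1 β
  have hq := one_lt_card_cast (F := F)
  rw [invertibleCount_fin, invertibleCount_fin, invertibleCount_fin, prod_range_succ _ (2 * k),
    prod_range_two_mul, prod_range_one,
    choose_two_two_mul,
    choose_two_of_two_mul_eq (n := 2 * k + 1) (N := (2 * k + 1) * k) (by simp; ring),
    choose_two_of_two_mul_eq (n := 2 * k + 1 + 1) (N := (2 * k + 1) * (k + 1)) (by simp; ring)] at h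
  rw [DCminus, Aminus, Bminus, qBinom, prod_range_one]
  rw [show (5 * (2 * k + 1) ^ 2 - 1) / 4 = 5 * k ^ 2 + 5 * k + 1 by
      rw [show 5 * (2 * k + 1) ^ 2 - 1 = 4 * (5 * k ^ 2 + 5 * k + 1) by
        exact Nat.sub_eq_of_eq_add (by ring), Nat.mul_div_cancel_left _ (by norm_num)],
    show (2 * k + 1 - 1) / 2 = k by omega, show (2 * k + 1 - 1) ^ 2 / 4 = k ^ 2 by
      rw [Nat.add_sub_cancel, mul_pow]; omega, Nat.add_sub_cancel]
  have hE := prod_Icc_pow_sub_one_pos hq k (fun j => 2 * j) (by omega)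
  have hO := prod_Icc_pow_sub_one_pos hq k (fun j => 2 * j - 1) (by omega)
  -- Naming K = k(k - 1) hides the truncated subtraction and makes every exponent linear in K and k.
  obtain ⟨K, hK, hK'⟩ : ∃ K, k * (k - 1) = K ∧ k ^ 2 = K + k :=
    ⟨_, rfl, by rcases k with - | k <;> simp; ring⟩
  rw [hK, show (2 * k + 1) * k = 2 * K + 3 * k by nlinarith,
    show (2 * k + 1) * (k + 1) = 2 * K + 5 * k + 1 by nlinarith, show Nat.choose 1 2 = 0 from rfl,
    show Nat.choose (1 + 1) 2 = 1 from rfl] at h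
  rw [hK']
  generalize (traceInvCount (Fin 1) β : ℚ) = m at *
  generalize ∏ j ∈ Icc 1 k, ((Fintype.card F : ℚ) ^ (2 * j - 1) - 1) = O at *
  generalize ∏ j ∈ Icc 1 k, ((Fintype.card F : ℚ) ^ (2 * j) - 1) = E at *
  generalize (Nat.card _ : ℚ) = N at *
  generalize (Fintype.card F : ℚ) = q at *
  have hq0 : q ≠ 0 := by positivity
  have hq1 : q - 1 ≠ 0 := by linarith
  -- This is the cofactor of N on the left of `h`, with the orders of the general linear groups
  -- expanded.
  have hX : q * (q ^ (2 * K + k) * (E * O) * (q - 1) * q ^ (4 * k + 1)) ≠ 0 := by positivity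
  refine mul_right_cancel₀ hX (Eq.trans ?_ (h.trans ?_))
  · ring
  · rw [Nat.sub_zero, pow_one]
    field_simp
    ring

theorem card_DCplus_trace [CharP F 2] [DecidableEq F] (k : ℕ) (β : F) :
    (Nat.card {w : DCplus (2 * k + 2) F // (w : Matrix (Fin (2 * k + 2) ⊕ Fin (2 * k + 2)) _ F).trace = β} : ℚ) =
      (Fintype.card F : ℚ)⁻¹ * Aplus (2 * k + 2) (Fintype.card F) *
        (Bplus (2 * k + 2) (Fintype.card F) +
          (traceInvCount (Fin 2) β - (Fintype.card F - 1) * (Fintype.card F ^ 2 - 1))) := by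
  have h := card_doubleCoset_sigma k 2 β
  have hq := one_lt_card_cast (F := F)
  rw [invertibleCount_fin, invertibleCount_fin, invertibleCount_fin, prod_range_succ _ (2 * k + 1),
    prod_range_succ _ (2 * k), prod_range_succ _ 1,
    prod_range_two_mul, prod_range_one,
    choose_two_two_mul,
    choose_two_of_two_mul_eq (n := 2 * k + 2) (N := (2 * k + 1) * (k + 1)) (by simp; ring),
    choose_two_of_two_mul_eq (n := 2 * k + 2 + 1) (N := (2 * k + 3) * (k + 1)) (by simp; ring)] at h
  rw [DCplus, Aplus, Bplus, qBinom, prod_range_succ _ 1, prod_range_one]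
  rw [show (5 * (2 * k + 2) ^ 2 - 2 * (2 * k + 2)) / 4 = 5 * k ^ 2 + 9 * k + 4 by
      rw [show 5 * (2 * k + 2) ^ 2 - 2 * (2 * k + 2) = 4 * (5 * k ^ 2 + 9 * k + 4) by
        exact Nat.sub_eq_of_eq_add (by ring), Nat.mul_div_cancel_left _ (by norm_num)],
    show (2 * k + 2 - 2) / 2 = k by omega, show (2 * k + 2 - 2) ^ 2 / 4 = k ^ 2 by
      rw [Nat.add_sub_cancel, mul_pow]; omega, Nat.add_sub_cancel]
  have hE := prod_Icc_pow_sub_one_pos hq k (fun j => 2 * j) (by omega)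
  have hO := prod_Icc_pow_sub_one_pos hq k (fun j => 2 * j - 1) (by omega)
  obtain ⟨K, hK, hK'⟩ : ∃ K, k * (k - 1) = K ∧ k ^ 2 = K + k :=
    ⟨_, rfl, by rcases k with - | k <;> simp; ring⟩
  rw [hK, show (2 * k + 1) * (k + 1) = 2 * K + 5 * k + 1 by nlinarith,
    show (2 * k + 3) * (k + 1) = 2 * K + 7 * k + 3 by nlinarith, show Nat.choose 2 2 = 1 from rfl,
    show Nat.choose (2 + 1) 2 = 3 from rfl] at h
  rw [hK']
  generalize (traceInvCount (Fin 2) β : ℚ) = m at *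
  generalize ∏ j ∈ Icc 1 k, ((Fintype.card F : ℚ) ^ (2 * j - 1) - 1) = O at *
  generalize ∏ j ∈ Icc 1 k, ((Fintype.card F : ℚ) ^ (2 * j) - 1) = E at *
  generalize (Nat.card _ : ℚ) = N at *
  generalize (Fintype.card F : ℚ) = q at *
  have hq0 : q ≠ 0 := by positivity
  have hq1 : q - 1 ≠ 0 := by linarith
  have hq2 : q ^ 2 - 1 ≠ 0 := (sub_pos.2 (one_lt_pow₀ hq two_ne_zero)).ne'
  have hX : q * (q ^ (2 * K + k) * (E * O) * (q * ((q - 1) * (q ^ 2 - 1))) *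
      q ^ (8 * k + 3)) ≠ 0 := by
    positivity
  refine mul_right_cancel₀ hX (Eq.trans ?_ (h.trans ?_))
  · ring
  · rw [Nat.sub_zero, show 2 - 1 = 1 from rfl, show 2 * k + 2 - 1 = 2 * k + 1 from rfl, pow_one]
    field_simp
    ring

theorem prod_eq_mul_prod_tr [DecidableEq F] [Algebra (ZMod 2) F] (f : F → ℚ) :
    ∏ β, f β = f 0 * (∏ β : F with β ≠ 0 ∧ tr F β⁻¹ = 0, f β) *
      ∏ β : F with β ≠ 0 ∧ tr F β⁻¹ = 1, f β := by
  rw [← mul_prod_erase univ f (mem_univ 0), mul_assoc, ← prod_filter_mul_prod_filter_not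
    (univ.erase 0) (fun β : F => tr F β⁻¹ = 0)]
  congr 2 <;> refine prod_congr (Finset.ext fun β => ?_) fun _ _ => rfl
  · simp
  · rcases tr_eq_zero_or_one (F := F) β⁻¹ with h | h <;> simp [h]

/-- The fibres over the τ in the range exhaust the nonzero β. This is the only place where the Hasse
bound and the congruence enter. -/
theorem prod_eq_mul_prod_kloosterman [DecidableEq F] [Algebra (ZMod 2) F]
    (hq : 4 ≤ Fintype.card F) (f : F → ℚ) :
    ∏ β, f β = f 0 * ∏ τ ∈ tauRange (Fintype.card F),
      ∏ β : F with β ≠ 0 ∧ kloosterman F β⁻¹ = τ, f β := by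
  rw [← mul_prod_erase univ f (mem_univ 0), ← prod_fiberwise_of_maps_to
    (s := univ.erase 0) (t := tauRange (Fintype.card F)) (g := fun β => kloosterman F β⁻¹)
    fun β hβ => kloosterman_mem_tauRange (inv_ne_zero (ne_of_mem_erase hβ)) hq]
  congr 2
  ext τ
  refine prod_congr (Finset.ext fun β => ?_) fun _ _ => rfl
  simp

theorem weightCount_traceCode_cast [DecidableEq F] [Algebra (ZMod 2) F] {m : Type*} [Fintype m]
    {S : Set (Matrix m m F)} {N : ℕ} (g : Fin N ≃ S) (j : ℕ) :
    (weightCount (traceCode g) j : ℚ) = ∑ ν ∈ families F j,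
      ∏ β, binom (Nat.card {w : S // (w : Matrix m m F).trace = β} : ℚ) (ν β) := by
  simp only [weightCount_traceCode, binom_natCast]
  push_cast
  rfl

end Counts

end SpCode

/-! ### The weight distributions of both families of codes -/

theorem theorem19 {F : Type*} [Field F] [Fintype F] [DecidableEq F] [Algebra (ZMod 2) F]
    (q : ℕ) (hq : Fintype.card F = q) :
    (∀ n : ℕ, Odd n →
      ∀ (g : Fin (SpCode.Nminus n F) ≃ SpCode.DCminus n F) (j : ℕ), j ≤ SpCode.Nminus n F →
        (SpCode.weightCount (SpCode.traceCode g) j : ℚ) =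
          ∑ ν ∈ SpCode.families F j,
            SpCode.binom ((q : ℚ)⁻¹ * SpCode.Aminus n q * (SpCode.Bminus n q + 1)) (ν 0) *
            (∏ β : F with β ≠ 0 ∧ SpCode.tr F β⁻¹ = 0,
              SpCode.binom ((q : ℚ)⁻¹ * SpCode.Aminus n q * (SpCode.Bminus n q + q + 1)) (ν β)) *
            (∏ β : F with β ≠ 0 ∧ SpCode.tr F β⁻¹ = 1,
              SpCode.binom ((q : ℚ)⁻¹ * SpCode.Aminus n q * (SpCode.Bminus n q - q + 1))
                (ν β))) ∧
    (4 ≤ q → ∀ n : ℕ, Even n → 2 ≤ n →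
      ∀ (g : Fin (SpCode.Nplus n F) ≃ SpCode.DCplus n F) (j : ℕ), j ≤ SpCode.Nplus n F →
        (SpCode.weightCount (SpCode.traceCode g) j : ℚ) =
          ∑ ν ∈ SpCode.families F j,
            SpCode.binom ((q : ℚ)⁻¹ * SpCode.Aplus n q *
              (SpCode.Bplus n q + (q : ℚ) ^ 3 - (q : ℚ) ^ 2 - 1)) (ν 0) *
            (∏ τ ∈ SpCode.tauRange q,
              ∏ β : F with β ≠ 0 ∧ SpCode.kloosterman F β⁻¹ = τ,
                SpCode.binom ((q : ℚ)⁻¹ * SpCode.Aplus n q *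
                  (SpCode.Bplus n q + (q : ℚ) * τ - (q : ℚ) ^ 2 - 1)) (ν β))) := by
  subst hq
  have := SpCode.charP_two F
  refine ⟨?_, ?_⟩
  · rintro n ⟨k, rfl⟩ g j -
    rw [SpCode.weightCount_traceCode_cast]
    refine Finset.sum_congr rfl fun ν _ => ?_
    rw [SpCode.prod_eq_mul_prod_tr]
    have h (β : F) : ((SpCode.traceInvCount (Fin 1) β : ℕ) : ℚ) =
        if β = 0 then 1 else 1 + (SpCode.canonicalChar F β⁻¹ : ℚ) := by
      exact_mod_cast congrArg (Int.cast (R := ℚ)) (SpCode.traceInvCount_fin_one β)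
    congr 1
    -- The correction q · #{x : x + x⁻¹ = β} - (q - 1) equals 1, q + 1 or 1 - q according as the
    -- equation has one, two or no solutions.
    · congr 1
      · rw [SpCode.card_DCminus_trace, h, if_pos rfl]
        congr 1
        ring
      · refine Finset.prod_congr rfl fun β hβ => ?_
        obtain ⟨-, h0, h1⟩ := Finset.mem_filter.1 hβ
        rw [SpCode.card_DCminus_trace, h, if_neg h0, SpCode.canonicalChar_eq_ite, if_pos h1]
        congr 1
        push_cast
        ring
    · refine Finset.prod_congr rfl fun β hβ => ?_
      obtain ⟨-, h0, h1⟩ := Finset.mem_filter.1 hβ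
      rw [SpCode.card_DCminus_trace, h, if_neg h0, SpCode.canonicalChar_eq_ite, h1,
        if_neg one_ne_zero]
      congr 1
      push_cast
      ring
  · rintro hq n hn hn2 g j -
    obtain ⟨k, rfl⟩ : ∃ k, n = 2 * k + 2 := by
      obtain ⟨m, rfl⟩ := hn
      exact ⟨m - 1, by omega⟩
    rw [SpCode.weightCount_traceCode_cast]
    refine Finset.sum_congr rfl fun ν _ => ?_
    rw [SpCode.prod_eq_mul_prod_kloosterman hq]
    congr 1
    -- Subtracting (q - 1)(q² - 1) from the size 2 count leaves q³ - q² - 1 at β = 0 and qτ - q² - 1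
    -- elsewhere.
    · have h := congrArg (Int.cast (R := ℚ)) (SpCode.traceInvCount_fin_two_zero (F := F))
      push_cast at h
      rw [SpCode.card_DCplus_trace, h]
      congr 1
      ring
    · refine Finset.prod_congr rfl fun τ _ => Finset.prod_congr rfl fun β hβ => ?_
      obtain ⟨-, h0, rfl⟩ := Finset.mem_filter.1 hβ
      have h := congrArg (Int.cast (R := ℚ)) (SpCode.traceInvCount_fin_two h0)
      push_cast at h
      rw [SpCode.card_DCplus_trace, h]
      congr 1
      ring
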